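/- Let $E$ be a $U$-site: a category with a Grothendieck topology, whose sets of morphisms are $U$-small and which has a $U$-small family of topological generators (objects such that every object of $E$ is covered by arrows from them). Sheaves are sheaves of $U$-small sets or groups. **Crossed groups.** A sheaf of crossed groups $(A,\Pi)$ on $E$ consists of sheaves of groups $A,\Pi$, a morphism $\rho\colon A\to\Pi$ and a left action of $\Pi$ on $A$ by group automorphisms such that $\rho(g\cdot a)=g\rho(a)g^{-1}$ and $\rho(a)\cdot b=aba^{-1}$. A morphism $(f,\varphi)\colon(A,\Pi)\to(A',\Pi')$ is a pair of morphisms of sheaves of groups $f\colon A\to A'$, $\varphi\colon\Pi\to\Pi'$ with $\rho' f=\varphi\rho$ and $f(g\cdot a)=\varphi(g)\cdot f(a)$. **Gerbes.** A gerbe $G$ on $E$ is a stack in groupoids over $E$ (with $U$-small sets of morphisms) such that every object $S$ of $E$ has a covering by objects over which $G$ has an object, and any two objects of a fibre $G_S$ are locally isomorphic. A morphism of gerbes is a cartesian functor over $E$. Write $\mathrm{Aut}(G)$ for the functor sending $x\in G_S$ to the sheaf of groups $\underline{\mathrm{Aut}}_S(x)$ on $E/S$. Write $\mathrm{TORSC}(\Pi)$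 for the gerbe whose objects over $S$ are the right $\Pi|_S$-torsors on $E/S$. For such a torsor $P$ let $P\wedge^{\Pi}A$ be the sheaf of groups on $E/S$ obtained as the quotient of $P\times A$ by $(pg,a)\sim(p,g\cdot a)$, and for $\varphi\colon\Pi\to\Pi'$ let $P\wedge^{\Pi}\Pi'$ be the $\Pi'$-torsor deduced from $P$ by extension of the structure group. Let $\mathrm{TORSC}(\varphi)\colon\mathrm{TORSC}(\Pi)\to\mathrm{TORSC}(\Pi')$ be the functor $P\mapsto P\wedge^{\Pi}\Pi'$. **$(A,\Pi)$-gerbes.** An $(A,\Pi)$-gerbe is a triple $(G,\mu,j)$ where $G$ is a gerbe on $E$, $\mu\colon G\to\mathrm{TORSC}(\Pi)$ is a morphism of gerbes, and $j\colon\mathrm{Aut}(G)\to(-\wedge^{\Pi}A)\circ\mu$ is a natural isomorphism lying over the identities of $E$, such that for every $x\in G_S$, every section $a_x$ of $\mu(x)\wedge^{\Pi}A$ over $S$ and every local representative $(\alpha,a)$ of $a_x$ one has $\mu(j^{-1}(a_x))(\alpha)=\alpha\cdot\rho(a)$. **Morphisms.** Let $(f,\varphi)\colon(A,\Pi)\to(A',\Pi')$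 be a morphism of sheaves of crossed groups, $(G,\mu,j)$ an $(A,\Pi)$-gerbe and $(G',\mu',j')$ an $(A',\Pi')$-gerbe. An $(f,\varphi)$-morphism $\lambda\colon(G,\mu,j)\to(G',\mu',j')$ is a morphism of gerbes $\lambda\colon G\to G'$ for which there is a natural isomorphism $i\colon\mathrm{TORSC}(\varphi)\circ\mu\to\mu'\circ\lambda$, lying over the identities of $E$, such that for every object $x$ of $G$ $$j'_{\lambda(x)}\circ\mathrm{Aut}(\lambda)_x=(i_x\wedge A')\circ(p_x\wedge f)\circ j_x .$$ Here $\mathrm{Aut}(\lambda)_x\colon\underline{\mathrm{Aut}}_S(x)\to\underline{\mathrm{Aut}}_S(\lambda(x))$ is $\theta\mapsto\lambda(\theta)$ and $p_x\colon\mu(x)\to\mu(x)\wedge^{\Pi}\Pi'$ is the canonical map $p\mapsto[p,1]$. The functor $\lambda$ is an $E$-equivalence if there are a cartesian functor $\lambda'\colon G'\to G$ over $E$ and natural isomorphisms $\lambda'\lambda\cong\mathrm{id}_G$ and $\lambda\lambda'\cong\mathrm{id}_{G'}$ lying over the identities of $E$. An $\mathrm{id}_{(A,\Pi)}$-morphism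 of $(A,\Pi)$-gerbes that is an $E$-equivalence is called an $(A,\Pi)$-equivalence. **Theorem.** If $(f,\varphi)\colon(A,\Pi)\to(A',\Pi')$ is an isomorphism of sheaves of crossed groups on $E$, then every $(f,\varphi)$-morphism $\lambda\colon(G,\mu,j)\to(G',\mu',j')$ from an $(A,\Pi)$-gerbe to an $(A',\Pi')$-gerbe is an $E$-equivalence. In particular, every $\mathrm{id}_{(A,\Pi)}$-morphism between $(A,\Pi)$-gerbes is an $(A,\Pi)$-equivalence. -/

import Mathlib

open CategoryTheory Opposite
universe w u v₁ u₁ v₂ u₂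
namespace CrossedGerbes

/-- A site in the universe of `w`-small sets: the sets of morphisms are `w`-small, and there is a
`w`-small topologically generating family `X` of objects, i.e. every object `S` is covered by the
morphisms to `S` from members of `X`. -/
class IsUSite {C : Type u} [Category.{w} C] (K : GrothendieckTopology C) : Prop where
  exists_generators : ∃ (ι : Type w) (X : ι → C), ∀ S : C,
    Sieve.generate (fun V (_ : V ⟶ S) => V ∈ Set.range X) ∈ K S

section
variable {C : Type u} [Category.{w} C] (K : GrothendieckTopology C)

instance [IsUSite K] (S : C) : IsUSite (K.over S) := by
  obtain ⟨ι, X, hX⟩ := IsUSite.exists_generators (K := K)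
  refine ⟨(Σ i, (X i ⟶ S)), fun p => Over.mk p.2, fun T => ?_⟩
  rw [GrothendieckTopology.mem_over_iff]
  refine K.superset_covering ?_ (hX T.left)
  rintro V f ⟨_, g, e, ⟨i, rfl⟩, rfl⟩
  rw [Sieve.overEquiv_iff]
  exact ⟨Over.mk (e ≫ T.hom), Over.homMk g (by simp), Over.homMk e, ⟨⟨i, e ≫ T.hom⟩, rfl⟩,
    by ext; rfl⟩

theorem exists_dense [h : IsUSite K] : ∃ (D : Type w) (_ : SmallCategory D) (F : D ⥤ C),
    F.Full ∧ F.Faithful ∧ F.IsCoverDense K := by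
  obtain ⟨ι, X, hX⟩ := h.exists_generators
  refine ⟨InducedCategory C X, inferInstance, inducedFunctor X, inferInstance, inferInstance,
    ⟨fun S => ?_⟩⟩
  refine K.superset_covering ?_ (hX S)
  rintro V f ⟨_, g, e, ⟨i, rfl⟩, rfl⟩
  exact ⟨⟨(i : InducedCategory C X), g, e, rfl⟩⟩

instance [IsUSite K] : HasSheafify K (Type w) := by
  obtain ⟨D, _, F, _, _, _⟩ := exists_dense K
  exact Functor.IsDenseSubsite.hasSheafify_of_isEquivalence (F.inducedTopology K) K F

instance [IsUSite K] : K.WEqualsLocallyBijective (Type w) := by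
  obtain ⟨D, _, F, _, _, _⟩ := exists_dense K
  exact GrothendieckTopology.WEqualsLocallyBijective.transport K (F.inducedTopology K) F
    (Functor.IsDenseSubsite.coverPreserving _ _ _)
end

section Torsors

variable {C : Type u} [Category.{w} C] {K : GrothendieckTopology C}

/-- Restriction of a section of a presheaf of sets. -/
abbrev res (F : Cᵒᵖ ⥤ Type w) {U V : C} (f : V ⟶ U) (x : F.obj (op U)) : F.obj (op V) :=
  F.map f.op x

/-- Restriction of a section of a presheaf of groups. -/
abbrev gres (H : Cᵒᵖ ⥤ GrpCat.{w}) {U V : C} (f : V ⟶ U) : H.obj (op U) →* H.obj (op V) :=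
  (H.map f.op).hom

/-- A (right) torsor under the sheaf of groups `H` on the site `(C, K)`. -/
structure Torsor (K : GrothendieckTopology C) (H : Sheaf K GrpCat.{w}) where
  sheaf : Sheaf K (Type w)
  act {U : C} : sheaf.obj.obj (op U) → H.obj.obj (op U) → sheaf.obj.obj (op U)
  act_one {U : C} (p : sheaf.obj.obj (op U)) : act p 1 = p
  act_mul {U : C} (p : sheaf.obj.obj (op U)) (g h : H.obj.obj (op U)) :
    act p (g * h) = act (act p g) h
  act_res {U V : C} (f : V ⟶ U) (p : sheaf.obj.obj (op U)) (g : H.obj.obj (op U)) :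
    res sheaf.obj f (act p g) = act (res sheaf.obj f p) (gres H.obj f g)
  simply_transitive {U : C} (p q : sheaf.obj.obj (op U)) : ∃! g, act p g = q
  locally_nonempty (U : C) :
    ∃ R ∈ K U, ∀ ⦃V : C⦄ (f : V ⟶ U), R f → Nonempty (sheaf.obj.obj (op V))

/-- A left action of the sheaf of groups `H` on the sheaf of sets `Q`. -/
structure LeftAction (H : Sheaf K GrpCat.{w}) (Q : Sheaf K (Type w)) where
  smul {U : C} : H.obj.obj (op U) → Q.obj.obj (op U) → Q.obj.obj (op U)
  one_smul {U : C} (q : Q.obj.obj (op U)) : smul 1 q = q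
  mul_smul {U : C} (g h : H.obj.obj (op U)) (q : Q.obj.obj (op U)) :
    smul (g * h) q = smul g (smul h q)
  smul_res {U V : C} (f : V ⟶ U) (g : H.obj.obj (op U)) (q : Q.obj.obj (op U)) :
    res Q.obj f (smul g q) = smul (gres H.obj f g) (res Q.obj f q)

variable {H : Sheaf K GrpCat.{w}} (P : Torsor K H) {Q : Sheaf K (Type w)} (L : LeftAction H Q)

/-- The equivalence relation of the diagonal action `(p, q) · g = (p · g, g⁻¹ · q)`. -/
def diagRel (U : C) (x y : P.sheaf.obj.obj (op U) × Q.obj.obj (op U)) : Prop :=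
  ∃ g : H.obj.obj (op U), y = (P.act x.1 g, L.smul g⁻¹ x.2)

/-- The quotient presheaf of `P × Q` by the diagonal action. -/
def contractedPre : Cᵒᵖ ⥤ Type w where
  obj U := Quot (diagRel P L U.unop)
  map f := ↾(Quot.map (fun x => (res P.sheaf.obj f.unop x.1, res Q.obj f.unop x.2)) (by
    rintro x y ⟨g, rfl⟩
    exact ⟨gres H.obj f.unop g, by simp [P.act_res, L.smul_res]⟩))
  map_id U := by
    ext x
    induction x using Quot.ind
    simp [res, Quot.map]
  map_comp f g := by
    ext x
    induction x using Quot.ind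
    simp [res, Quot.map]

theorem sep (X : Sheaf K (Type w)) {U : C} {R : Sieve U} (hR : R ∈ K U)
    {x y : X.obj.obj (op U)} (h : ∀ ⦃V : C⦄ (f : V ⟶ U), R f → res X.obj f x = res X.obj f y) :
    x = y :=
  (((isSheaf_iff_isSheaf_of_type K X.obj).1 X.property).isSeparated R hR).ext h

theorem diagRel_equivalence (U : C) : Equivalence (diagRel P L U) where
  refl x := ⟨1, by simp [P.act_one, L.one_smul]⟩
  symm := by
    rintro x _ ⟨g, rfl⟩
    exact ⟨g⁻¹, by simp [← P.act_mul, ← L.mul_smul, P.act_one, L.one_smul]⟩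
  trans := by
    rintro x _ _ ⟨g, rfl⟩ ⟨h, rfl⟩
    exact ⟨g * h, by simp [P.act_mul, L.mul_smul]⟩

theorem act_eq_self {U : C} {p : P.sheaf.obj.obj (op U)} {g : H.obj.obj (op U)}
    (h : P.act p g = p) : g = 1 :=
  (P.simply_transitive p p).unique h (P.act_one p)

theorem res_res (X : Cᵒᵖ ⥤ Type w) {U V W : C} (g : W ⟶ V) (f : V ⟶ U) (x : X.obj (op U)) :
    res X g (res X f x) = res X (g ≫ f) x := by
  simp [res]

/-- Descent along the torsor `P`. -/
theorem glue (X : Sheaf K (Type w)) {U : C}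
    (e : ∀ ⦃V : C⦄ (_ : V ⟶ U), P.sheaf.obj.obj (op V) → X.obj.obj (op V))
    (e_res : ∀ ⦃V W : C⦄ (g : W ⟶ V) (f : V ⟶ U) (p),
      res X.obj g (e f p) = e (g ≫ f) (res P.sheaf.obj g p))
    (e_act : ∀ ⦃V : C⦄ (f : V ⟶ U) (p) (h : H.obj.obj (op V)), e f (P.act p h) = e f p) :
    ∃! z : X.obj.obj (op U), ∀ ⦃V : C⦄ (f : V ⟶ U) (p), res X.obj f z = e f p := by
  obtain ⟨R, hR, hne⟩ := P.locally_nonempty U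
  have e_indep : ∀ ⦃V : C⦄ (f : V ⟶ U) (p q), e f p = e f q := by
    intro V f p q
    obtain ⟨g, rfl, -⟩ := P.simply_transitive p q
    rw [e_act]
  have hs := (isSheaf_iff_isSheaf_of_type K X.obj).1 X.property R hR
  have hc : Presieve.FamilyOfElements.Compatible
      (P := X.obj) (R := R.arrows) (fun V f hf => e f (hne f hf).some) := by
    intro Y₁ Y₂ Z g₁ g₂ f₁ f₂ h₁ h₂ h
    refine (e_res _ _ _).trans (Eq.trans ?_ (e_res _ _ _).symm)
    rw [h]
    exact e_indep _ _ _
  refine ⟨hs.amalgamate _ hc, fun V f p => ?_, fun y hy => sep X hR fun V f hf => ?_⟩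
  · refine sep X (K.pullback_stable f hR) fun W g hg => ?_
    rw [res_res, e_res]
    exact (hs.valid_glue hc _ hg).trans (e_indep _ _ _)
  · rw [hy f (hne f hf).some]
    exact (hs.valid_glue hc _ hf).symm

/-- Equality of sections may be tested where `P` has a section. -/
theorem sep_torsor (X : Sheaf K (Type w)) {U : C} {x y : X.obj.obj (op U)}
    (h : ∀ ⦃V : C⦄ (f : V ⟶ U) (_ : P.sheaf.obj.obj (op V)), res X.obj f x = res X.obj f y) :
    x = y := by
  obtain ⟨R, hR, hne⟩ := P.locally_nonempty U
  exact sep X hR fun V f hf => h f (hne f hf).some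

variable [IsUSite K]

/-- The contracted product: the quotient sheaf of `P × Q` by the diagonal action. -/
noncomputable def contracted : Sheaf K (Type w) :=
  (presheafToSheaf K (Type w)).obj (contractedPre P L)

/-- The image of `(p, q)` in the contracted product. -/
noncomputable def pair {U : C} (p : P.sheaf.obj.obj (op U)) (q : Q.obj.obj (op U)) :
    (contracted P L).obj.obj (op U) :=
  (toSheafify K (contractedPre P L)).app (op U) (Quot.mk _ (p, q))

theorem pair_res {U V : C} (f : V ⟶ U) (p : P.sheaf.obj.obj (op U)) (q : Q.obj.obj (op U)) :
    res (contracted P L).obj f (pair P L p q) =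
      pair P L (res P.sheaf.obj f p) (res Q.obj f q) :=
  (NatTrans.naturality_apply (toSheafify K (contractedPre P L)) f.op _).symm

theorem pair_act {U : C} (p : P.sheaf.obj.obj (op U)) (g : H.obj.obj (op U))
    (q : Q.obj.obj (op U)) : pair P L (P.act p g) q = pair P L p (L.smul g q) := by
  refine congrArg ((toSheafify K (contractedPre P L)).app (op U)) (Quot.sound ?_).symm
  exact ⟨g, by rw [← L.mul_smul]; simp [L.one_smul]⟩

theorem exists_locally_pair {U : C} (x : (contracted P L).obj.obj (op U)) :
    ∃ R ∈ K U, ∀ ⦃V : C⦄ (f : V ⟶ U), R f → ∃ p q, res (contracted P L).obj f x = pair P L p q := by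
  refine ⟨_, Presheaf.imageSieve_mem K (toSheafify K (contractedPre P L)) x, ?_⟩
  rintro V f ⟨y, hy⟩
  induction y using Quot.ind with
  | mk z => exact ⟨z.1, z.2, hy.symm⟩

theorem pair_injective {U : C} (p : P.sheaf.obj.obj (op U)) :
    Function.Injective (pair P L p) := by
  intro a b hab
  refine sep Q (Presheaf.equalizerSieve_mem K (toSheafify K (contractedPre P L)) _ _ hab) ?_
  intro V f hf
  have h : Quot.mk (diagRel P L V) (res P.sheaf.obj f p, res Q.obj f a) =
    Quot.mk (diagRel P L V) (res P.sheaf.obj f p, res Q.obj f b) := hf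
  obtain ⟨g, hg⟩ := ((diagRel_equivalence P L V).quot_mk_eq_iff _ _).1 h
  rw [Prod.mk.injEq] at hg
  rw [hg.2, act_eq_self P hg.1.symm, inv_one, L.one_smul]

/-- A section of `P` identifies the contracted product with `Q`. -/
theorem pair_bijective {U : C} (p : P.sheaf.obj.obj (op U)) :
    Function.Bijective (pair P L p) := by
  refine ⟨pair_injective P L p, fun x => ?_⟩
  obtain ⟨R, hR, h⟩ := exists_locally_pair P L x
  have h' : ∀ ⦃V : C⦄ (f : V ⟶ U), R f →
      ∃ q, res (contracted P L).obj f x = pair P L (res P.sheaf.obj f p) q := by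
    intro V f hf
    obtain ⟨p', q', hx⟩ := h f hf
    obtain ⟨g, rfl, -⟩ := P.simply_transitive (res P.sheaf.obj f p) p'
    exact ⟨L.smul g q', by rw [hx, pair_act]⟩
  choose t ht using h'
  have hs := (isSheaf_iff_isSheaf_of_type K Q.obj).1 Q.property R hR
  have hc : Presieve.FamilyOfElements.Compatible
      (P := Q.obj) (R := R.arrows) (fun V f hf => t f hf) := by
    intro Y₁ Y₂ Z g₁ g₂ f₁ f₂ h₁ h₂ e
    apply pair_injective P L (res P.sheaf.obj (g₁ ≫ f₁) p)
    have e₁ := congrArg (res (contracted P L).obj g₁) (ht f₁ h₁)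
    have e₂ := congrArg (res (contracted P L).obj g₂) (ht f₂ h₂)
    rw [res_res, pair_res, res_res] at e₁ e₂
    rw [← e] at e₂
    exact e₁.symm.trans e₂
  refine ⟨hs.amalgamate _ hc, sep _ hR fun V f hf => ?_⟩
  rw [pair_res, ht f hf]
  exact congrArg _ (hs.valid_glue hc f hf)

/-- The coordinate in `Q` of a section of the contracted product, relative to a section of `P`. -/
noncomputable def coord {U : C} (p : P.sheaf.obj.obj (op U))
    (x : (contracted P L).obj.obj (op U)) : Q.obj.obj (op U) :=
  ((pair_bijective P L p).2 x).choose

@[simp] theorem pair_coord {U : C} (p : P.sheaf.obj.obj (op U))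
    (x : (contracted P L).obj.obj (op U)) : pair P L p (coord P L p x) = x :=
  ((pair_bijective P L p).2 x).choose_spec

@[simp] theorem coord_pair {U : C} (p : P.sheaf.obj.obj (op U)) (q : Q.obj.obj (op U)) :
    coord P L p (pair P L p q) = q :=
  pair_injective P L p (pair_coord P L p _)

theorem coord_res {U V : C} (f : V ⟶ U) (p : P.sheaf.obj.obj (op U))
    (x : (contracted P L).obj.obj (op U)) :
    coord P L (res P.sheaf.obj f p) (res (contracted P L).obj f x) =
      res Q.obj f (coord P L p x) :=
  pair_injective P L (res P.sheaf.obj f p) (by rw [pair_coord, ← pair_res, pair_coord])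

theorem coord_act {U : C} (p : P.sheaf.obj.obj (op U)) (g : H.obj.obj (op U))
    (x : (contracted P L).obj.obj (op U)) :
    coord P L (P.act p g) x = L.smul g⁻¹ (coord P L p x) :=
  pair_injective P L (P.act p g) (by
    rw [pair_coord, pair_act, ← L.mul_smul, mul_inv_cancel, L.one_smul, pair_coord])

end Torsors

section Twist

variable {C : Type u} [Category.{w} C] {K : GrothendieckTopology C}

/-- A presheaf of groups is a sheaf if the underlying presheaf of sets is one. -/
theorem isSheaf_of_forget (F : Cᵒᵖ ⥤ GrpCat.{w})
    (h : Presheaf.IsSheaf K (F ⋙ forget GrpCat.{w})) : Presheaf.IsSheaf K F := by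
  intro T U R hR x hx
  have hs := (isSheaf_iff_isSheaf_of_type K _).1 h R hR
  have hc : ∀ t : T, Presieve.FamilyOfElements.Compatible
      (P := F ⋙ forget GrpCat.{w}) (R := R.arrows) (fun V f hf => (x f hf).hom t) := by
    intro t Y₁ Y₂ Z g₁ g₂ f₁ f₂ h₁ h₂ e
    exact congrArg (fun k : T ⟶ F.obj (op Z) => k.hom t) (hx g₁ g₂ h₁ h₂ e)
  let z : T → F.obj (op U) := fun t => hs.amalgamate _ (hc t)
  have hz : ∀ t ⦃V : C⦄ (f : V ⟶ U) (hf : R f), gres F f (z t) = (x f hf).hom t :=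
    fun t V f hf => hs.valid_glue (hc t) f hf
  have hsep : ∀ a b : F.obj (op U), (∀ ⦃V : C⦄ (f : V ⟶ U), R f → gres F f a = gres F f b) →
      a = b := fun a b hab => hs.isSeparatedFor.ext hab
  refine ⟨GrpCat.ofHom
    { toFun := z
      map_one' := hsep _ _ fun V f hf => by rw [hz _ f hf, map_one, map_one]
      map_mul' := fun s t => hsep _ _ fun V f hf => by
        rw [map_mul, hz _ f hf, hz _ f hf, hz _ f hf, map_mul] }, fun V f hf => ?_, fun y hy => ?_⟩
  · refine GrpCat.hom_ext (MonoidHom.ext fun t => ?_)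
    exact hz t f hf
  · refine GrpCat.hom_ext (MonoidHom.ext fun t => ?_)
    refine hsep _ _ fun V f hf => ?_
    exact (congrArg (fun k : T ⟶ F.obj (op V) => k.hom t) (hy f hf)).trans (hz t f hf).symm

/-- The underlying sheaf of sets of a sheaf of groups. -/
abbrev setSheaf (A : Sheaf K GrpCat.{w}) : Sheaf K (Type w) :=
  (sheafCompose K (forget GrpCat.{w})).obj A

/-- A left action of the sheaf of groups `H` on the sheaf of groups `A` by group automorphisms. -/
structure GroupAction (H A : Sheaf K GrpCat.{w}) where
  act (U : C) : H.obj.obj (op U) →* MulAut (A.obj.obj (op U))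
  act_res {U V : C} (f : V ⟶ U) (g : H.obj.obj (op U)) (a : A.obj.obj (op U)) :
    gres A.obj f (act U g a) = act V (gres H.obj f g) (gres A.obj f a)

/-- The underlying action on the sheaf of sets. -/
def GroupAction.toLeft {H A : Sheaf K GrpCat.{w}} (L : GroupAction H A) :
    LeftAction H (setSheaf A) where
  smul {U} g a := L.act U g a
  one_smul {U} q := by rw [map_one]; rfl
  mul_smul g h q := by rw [map_mul]; rfl
  smul_res f g q := L.act_res f g q

theorem hom_gres {H H' : Sheaf K GrpCat.{w}} (φ : H ⟶ H') {U V : C} (f : V ⟶ U)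
    (g : H.obj.obj (op U)) :
    gres H'.obj f ((φ.hom.app (op U)).hom g) = (φ.hom.app (op V)).hom (gres H.obj f g) :=
  (NatTrans.naturality_apply φ.hom f.op g).symm

/-- The action of `H` on `H'` by left translations through a morphism `H ⟶ H'`. -/
def translation {H H' : Sheaf K GrpCat.{w}} (φ : H ⟶ H') : LeftAction H (setSheaf H') where
  smul {U} g a := ((φ.hom.app (op U)).hom g : H'.obj.obj (op U)) * (show H'.obj.obj (op U) from a)
  one_smul {U} q := by rw [map_one]; exact one_mul (show H'.obj.obj (op U) from q)
  mul_smul {U} g h q := by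
    rw [map_mul]
    exact mul_assoc _ _ (show H'.obj.obj (op U) from q)
  smul_res {U V} f g q := by
    refine (map_mul (gres H'.obj f) _ _).trans ?_
    rw [hom_gres]
    rfl

variable [IsUSite K] {H : Sheaf K GrpCat.{w}} (P : Torsor K H) {A : Sheaf K GrpCat.{w}}

section

variable (L : LeftAction H (setSheaf A))

/-- The element of the contracted product represented by `(p, a)`. -/
noncomputable def gpair {U : C} (p : P.sheaf.obj.obj (op U)) (a : A.obj.obj (op U)) :
    (contracted P L).obj.obj (op U) := pair P L p a

/-- The inverse of `a ↦ (p, a)`. -/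
noncomputable def gcoord {U : C} (p : P.sheaf.obj.obj (op U))
    (x : (contracted P L).obj.obj (op U)) : A.obj.obj (op U) := coord P L p x

/-- The left action, on sections of the sheaf of groups. -/
def gsmul {U : C} (g : H.obj.obj (op U)) (a : A.obj.obj (op U)) : A.obj.obj (op U) :=
  L.smul g a

theorem gpair_res {U V : C} (f : V ⟶ U) (p : P.sheaf.obj.obj (op U)) (a : A.obj.obj (op U)) :
    res (contracted P L).obj f (gpair P L p a) =
      gpair P L (res P.sheaf.obj f p) (gres A.obj f a) := pair_res P L f p a

theorem gpair_act {U : C} (p : P.sheaf.obj.obj (op U)) (g : H.obj.obj (op U))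
    (a : A.obj.obj (op U)) : gpair P L (P.act p g) a = gpair P L p (gsmul L g a) :=
  pair_act P L p g a

@[simp] theorem gpair_gcoord {U : C} (p : P.sheaf.obj.obj (op U))
    (x : (contracted P L).obj.obj (op U)) : gpair P L p (gcoord P L p x) = x :=
  pair_coord P L p x

@[simp] theorem gcoord_gpair {U : C} (p : P.sheaf.obj.obj (op U)) (a : A.obj.obj (op U)) :
    gcoord P L p (gpair P L p a) = a := coord_pair P L p a

theorem gpair_injective {U : C} (p : P.sheaf.obj.obj (op U)) {a b : A.obj.obj (op U)}
    (h : gpair P L p a = gpair P L p b) : a = b := pair_injective P L p h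

theorem gcoord_res {U V : C} (f : V ⟶ U) (p : P.sheaf.obj.obj (op U))
    (x : (contracted P L).obj.obj (op U)) :
    gcoord P L (res P.sheaf.obj f p) (res (contracted P L).obj f x) =
      gres A.obj f (gcoord P L p x) := coord_res P L f p x

theorem gcoord_act {U : C} (p : P.sheaf.obj.obj (op U)) (g : H.obj.obj (op U))
    (x : (contracted P L).obj.obj (op U)) :
    gcoord P L (P.act p g) x = gsmul L g⁻¹ (gcoord P L p x) := coord_act P L p g x

theorem gsmul_inv_smul {U : C} (g : H.obj.obj (op U)) (a : A.obj.obj (op U)) :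
    gsmul L g (gsmul L g⁻¹ a) = a := by
  refine (L.mul_smul g g⁻¹ a).symm.trans ?_
  rw [mul_inv_cancel]
  exact L.one_smul a

end

section

variable (L : GroupAction H A)

/-- The multiplication of the twist `P ∧ A`: locally `(p, a) · (p, b) = (p, a b)`. -/
theorem exists_mul {U : C} (x y : (contracted P L.toLeft).obj.obj (op U)) :
    ∃! z : (contracted P L.toLeft).obj.obj (op U),
      ∀ ⦃V : C⦄ (f : V ⟶ U) (p : P.sheaf.obj.obj (op V)),
        res (contracted P L.toLeft).obj f z = gpair P L.toLeft p
          (gcoord P L.toLeft p (res (contracted P L.toLeft).obj f x) *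
            gcoord P L.toLeft p (res (contracted P L.toLeft).obj f y)) := by
  refine glue P _ (fun V f p => gpair P L.toLeft p
          (gcoord P L.toLeft p (res (contracted P L.toLeft).obj f x) *
            gcoord P L.toLeft p (res (contracted P L.toLeft).obj f y))) ?_ ?_
  · intro V W g f p
    rw [gpair_res, ← res_res, ← res_res, gcoord_res, gcoord_res, map_mul]
  · intro V f p h
    rw [gcoord_act, gcoord_act, gpair_act]
    congr 1
    refine (map_mul (L.act V h) _ _).trans ?_
    exact congrArg₂ (· * ·) (gsmul_inv_smul L.toLeft _ _) (gsmul_inv_smul L.toLeft _ _)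

theorem exists_inv {U : C} (x : (contracted P L.toLeft).obj.obj (op U)) :
    ∃! z : (contracted P L.toLeft).obj.obj (op U),
      ∀ ⦃V : C⦄ (f : V ⟶ U) (p : P.sheaf.obj.obj (op V)),
        res (contracted P L.toLeft).obj f z = gpair P L.toLeft p
          (gcoord P L.toLeft p (res (contracted P L.toLeft).obj f x))⁻¹ := by
  refine glue P _ (fun V f p => gpair P L.toLeft p
          (gcoord P L.toLeft p (res (contracted P L.toLeft).obj f x))⁻¹) ?_ ?_
  · intro V W g f p
    rw [gpair_res, ← res_res, gcoord_res, map_inv]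
  · intro V f p h
    rw [gcoord_act, gpair_act]
    congr 1
    refine (map_inv (L.act V h) _).trans ?_
    exact congrArg (·⁻¹) (gsmul_inv_smul L.toLeft _ _)

theorem exists_one (U : C) :
    ∃! z : (contracted P L.toLeft).obj.obj (op U),
      ∀ ⦃V : C⦄ (f : V ⟶ U) (p : P.sheaf.obj.obj (op V)),
        res (contracted P L.toLeft).obj f z = gpair P L.toLeft p 1 := by
  refine glue P _ (fun V f p => gpair P L.toLeft p 1) ?_ ?_
  · intro V W g f p
    rw [gpair_res, map_one]
  · intro V f p h
    rw [gpair_act]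
    congr 1
    exact map_one (L.act V h)

noncomputable instance twistMul (U : C) : Mul ((contracted P L.toLeft).obj.obj (op U)) :=
  ⟨fun x y => (exists_mul P L x y).choose⟩

noncomputable instance twistInv (U : C) : Inv ((contracted P L.toLeft).obj.obj (op U)) :=
  ⟨fun x => (exists_inv P L x).choose⟩

noncomputable instance twistOne (U : C) : One ((contracted P L.toLeft).obj.obj (op U)) :=
  ⟨(exists_one P L U).choose⟩

theorem twist_mul_res {U V : C} (f : V ⟶ U) (x y : (contracted P L.toLeft).obj.obj (op U))
    (p : P.sheaf.obj.obj (op V)) :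
    res (contracted P L.toLeft).obj f (x * y) = gpair P L.toLeft p
      (gcoord P L.toLeft p (res (contracted P L.toLeft).obj f x) *
        gcoord P L.toLeft p (res (contracted P L.toLeft).obj f y)) :=
  (exists_mul P L x y).choose_spec.1 f p

theorem twist_inv_res {U V : C} (f : V ⟶ U) (x : (contracted P L.toLeft).obj.obj (op U))
    (p : P.sheaf.obj.obj (op V)) :
    res (contracted P L.toLeft).obj f x⁻¹ = gpair P L.toLeft p
      (gcoord P L.toLeft p (res (contracted P L.toLeft).obj f x))⁻¹ :=
  (exists_inv P L x).choose_spec.1 f p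

theorem twist_one_res {U V : C} (f : V ⟶ U) (p : P.sheaf.obj.obj (op V)) :
    res (contracted P L.toLeft).obj f (1 : (contracted P L.toLeft).obj.obj (op U)) =
      gpair P L.toLeft p 1 :=
  (exists_one P L U).choose_spec.1 f p

noncomputable instance twistGroup (U : C) : Group ((contracted P L.toLeft).obj.obj (op U)) where
  mul_assoc x y z := by
    refine sep_torsor P _ fun V f p => ?_
    simp only [twist_mul_res P L f _ _ p, gcoord_gpair, mul_assoc]
  one_mul x := by
    refine sep_torsor P _ fun V f p => ?_
    simp only [twist_mul_res P L f _ _ p, twist_one_res P L f p, gcoord_gpair, one_mul,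
      gpair_gcoord]
  mul_one x := by
    refine sep_torsor P _ fun V f p => ?_
    simp only [twist_mul_res P L f _ _ p, twist_one_res P L f p, gcoord_gpair, mul_one,
      gpair_gcoord]
  inv_mul_cancel x := by
    refine sep_torsor P _ fun V f p => ?_
    simp only [twist_mul_res P L f _ _ p, twist_one_res P L f p, twist_inv_res P L f _ p,
      gcoord_gpair, inv_mul_cancel]

theorem res_mul {U V : C} (f : V ⟶ U) (x y : (contracted P L.toLeft).obj.obj (op U)) :
    res (contracted P L.toLeft).obj f (x * y) =
      res (contracted P L.toLeft).obj f x * res (contracted P L.toLeft).obj f y := by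
  refine sep_torsor P _ fun W g p => ?_
  rw [res_res, twist_mul_res P L _ _ _ p, twist_mul_res P L _ _ _ p, res_res, res_res]

/-- The group law is the one transported from `A` by `a ↦ (p, a)`. -/
theorem gpair_mul {U : C} (p : P.sheaf.obj.obj (op U)) (a b : A.obj.obj (op U)) :
    gpair P L.toLeft p (a * b) = gpair P L.toLeft p a * gpair P L.toLeft p b := by
  have h := twist_mul_res P L (𝟙 U) (gpair P L.toLeft p a) (gpair P L.toLeft p b) p
  have e : ∀ x : (contracted P L.toLeft).obj.obj (op U),
    res (contracted P L.toLeft).obj (𝟙 U) x = x := fun x => by simp [res]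
  rw [e, e, e, gcoord_gpair, gcoord_gpair] at h
  exact h.symm

/-- The twist of `A` by the torsor `P`: the contracted product as a sheaf of groups. -/
noncomputable def twist : Sheaf K GrpCat.{w} where
  obj :=
    { obj := fun U => GrpCat.of ((contracted P L.toLeft).obj.obj (op U.unop))
      map := fun f => GrpCat.ofHom
        { toFun := res (contracted P L.toLeft).obj f.unop
          map_one' := by
            refine sep_torsor P _ fun W g p => ?_
            rw [res_res, twist_one_res P L _ p, twist_one_res P L _ p]
          map_mul' := res_mul P L f.unop }
      map_id := fun U => by
        ext x
        simp [res]
      map_comp := fun f g => by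
        ext x
        simp [res] }
  property := isSheaf_of_forget _ (contracted P L.toLeft).property

end
end Twist

section Slices

variable {E : Type u} [Category.{w} E]

/-- A sheaf with values in `D` on the localized site `E/S`, for a variable object `S`. -/
structure SliceSheaf (J : GrothendieckTopology E) (D : Type u₁) [Category.{v₁} D] where
  base : E
  sheaf : Sheaf (J.over base) D

namespace SliceSheaf

variable {J : GrothendieckTopology E} {D : Type u₁} [Category.{v₁} D]

/-- The value on the object `t : U ⟶ S` of `E/S`. -/
abbrev val (X : SliceSheaf J D) {U : E} (t : U ⟶ X.base) : D :=
  X.sheaf.obj.obj (op (Over.mk t))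

/-- The restriction along a morphism `u` of `E/S`. -/
abbrev valMap (X : SliceSheaf J D) {U V : E} (u : V ⟶ U) {t : U ⟶ X.base} {t' : V ⟶ X.base}
    (h : u ≫ t = t') : X.val t ⟶ X.val t' :=
  X.sheaf.obj.map (Over.homMk u h : Over.mk t' ⟶ Over.mk t).op

/-- A morphism over `f : S ⟶ T` from a sheaf `X` on `E/S` to a sheaf `Y` on `E/T`, that is,
a morphism from `X` to the restriction of `Y` along `f`: the value of this restriction on
`t : U ⟶ S` is the value of `Y` on `s = f ∘ t`. -/
structure Hom (X Y : SliceSheaf J D) where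
  base : X.base ⟶ Y.base
  app {U : E} (t : U ⟶ X.base) (s : U ⟶ Y.base) (h : t ≫ base = s) : X.val t ⟶ Y.val s
  naturality {U V : E} (u : V ⟶ U) {t : U ⟶ X.base} {s : U ⟶ Y.base} (h : t ≫ base = s)
    {t' : V ⟶ X.base} {s' : V ⟶ Y.base} (h' : t' ≫ base = s') (ht : u ≫ t = t')
    (hs : u ≫ s = s') : X.valMap u ht ≫ app t' s' h' = app t s h ≫ Y.valMap u hs

theorem Hom.ext' {X Y : SliceSheaf J D} {m n : Hom X Y} (hb : m.base = n.base)
    (ha : ∀ {U : E} (t : U ⟶ X.base) (s : U ⟶ Y.base) (h : t ≫ m.base = s)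
      (h' : t ≫ n.base = s), m.app t s h = n.app t s h') : m = n := by
  obtain ⟨b, a, _⟩ := m
  obtain ⟨b', a', _⟩ := n
  obtain rfl : b = b' := hb
  congr
  funext U t s h
  exact ha t s h h

/-- The identity. -/
def Hom.id (X : SliceSheaf J D) : Hom X X where
  base := 𝟙 _
  app _ _ h := X.valMap (𝟙 _) (by simpa using h)
  naturality u t s h t' s' h' ht hs := by
    rw [← Functor.map_comp, ← Functor.map_comp, ← op_comp, ← op_comp]
    congr 2
    ext
    simp

/-- The composition. -/
def Hom.comp {X Y Z : SliceSheaf J D} (m : Hom X Y) (n : Hom Y Z) : Hom X Z where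
  base := m.base ≫ n.base
  app t s h := m.app t (t ≫ m.base) rfl ≫ n.app (t ≫ m.base) s (by simpa using h)
  naturality u t s h t' s' h' ht hs := by
    rw [← Category.assoc, m.naturality u rfl rfl ht (by rw [← ht, Category.assoc]),
      Category.assoc, n.naturality u _ _ _ hs, Category.assoc]

theorem Hom.id_app (X : SliceSheaf J D) {U : E} (t : U ⟶ X.base) (h : t ≫ 𝟙 X.base = t) :
    (Hom.id X).app t t h = 𝟙 (X.val t) := by
  refine Eq.trans ?_ (CategoryTheory.Functor.map_id _ _)
  rfl

theorem Hom.comp_app {X Y Z : SliceSheaf J D} (m : Hom X Y) (n : Hom Y Z) {U : E}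
    (t : U ⟶ X.base) (s : U ⟶ Y.base) (r : U ⟶ Z.base) (h : t ≫ m.base = s)
    (h' : s ≫ n.base = r) (h'' : t ≫ (m.comp n).base = r) :
    (m.comp n).app t r h'' = m.app t s h ≫ n.app s r h' := by
  subst h
  rfl

instance : Category (SliceSheaf J D) where
  Hom := Hom
  id := Hom.id
  comp := Hom.comp
  id_comp m := by
    refine Hom.ext' (Category.id_comp _) fun t s h h' => ?_
    rw [Hom.comp_app _ _ t t s (Category.comp_id t) h', Hom.id_app, Category.id_comp]
  comp_id m := by
    refine Hom.ext' (Category.comp_id _) fun t s h h' => ?_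
    rw [Hom.comp_app _ _ t s s h' (Category.comp_id s), Hom.id_app, Category.comp_id]
  assoc m n k := by
    refine Hom.ext' (Category.assoc _ _ _) fun t s h h' => ?_
    have e : ((t ≫ m.base) ≫ n.base) ≫ k.base = s := by
      rw [← h']
      exact ((Category.assoc _ _ _).trans (Category.assoc _ _ _))
    refine (Hom.comp_app (m.comp n) k t ((t ≫ m.base) ≫ n.base) s
      (Category.assoc _ _ _).symm e _).trans ?_
    refine Eq.trans ?_ (Hom.comp_app m (n.comp k) t (t ≫ m.base) s rfl
      ((Category.assoc _ _ _).symm.trans e) _).symm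
    refine (congrArg (· ≫ _) (Hom.comp_app m n t (t ≫ m.base) _ rfl rfl _)).trans ?_
    refine Eq.trans ?_ (congrArg (_ ≫ ·)
      (Hom.comp_app n k (t ≫ m.base) ((t ≫ m.base) ≫ n.base) s rfl e _)).symm
    exact Category.assoc _ _ _

theorem hom_ext {X Y : SliceSheaf J D} {m n : X ⟶ Y} (hb : m.base = n.base)
    (ha : ∀ {U : E} (t : U ⟶ X.base) (s : U ⟶ Y.base) (h : t ≫ m.base = s)
      (h' : t ≫ n.base = s), m.app t s h = n.app t s h') : m = n := Hom.ext' hb ha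

theorem id_app (X : SliceSheaf J D) {U : E} (t : U ⟶ X.base) (h : t ≫ 𝟙 X.base = t) :
    Hom.app (𝟙 X) t t h = 𝟙 (X.val t) :=
  Hom.id_app X t h

theorem comp_app {X Y Z : SliceSheaf J D} (m : X ⟶ Y) (n : Y ⟶ Z) {U : E} (t : U ⟶ X.base)
    (s : U ⟶ Y.base) (r : U ⟶ Z.base) (h : t ≫ m.base = s) (h' : s ≫ n.base = r)
    (h'' : t ≫ (m ≫ n).base = r) : (m ≫ n).app t r h'' = m.app t s h ≫ n.app s r h' :=
  Hom.comp_app m n t s r h h' h''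

/-- The projection to the base category. -/
@[simps] def proj (J : GrothendieckTopology E) (D : Type u₁) [Category.{v₁} D] :
    SliceSheaf J D ⥤ E where
  obj X := X.base
  map m := m.base

end SliceSheaf

/-- The category over `E` of sheaves of groups on the localized sites `E/S`. -/
abbrev FAGRSC (J : GrothendieckTopology E) := SliceSheaf J GrpCat.{w}

end Slices

section CrossedGroups

variable {E : Type u} [Category.{w} E]

/-- The value of a morphism of sheaves of groups on sections over `U`. -/
abbrev onSec {J : GrothendieckTopology E} {H H' : Sheaf J GrpCat.{w}} (φ : H ⟶ H') {U : E} :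
    H.obj.obj (op U) →* H'.obj.obj (op U) :=
  (φ.hom.app (op U)).hom

/-- A sheaf of crossed groups (crossed modules) `ρ : A ⟶ Π`: the sheaf of groups `Π` acts on the
left on the sheaf of groups `A` by automorphisms, `ρ (g • a) = g ρ(a) g⁻¹` and
`ρ(a) • b = a b a⁻¹`. -/
structure CrossedGroupSheaf (J : GrothendieckTopology E) where
  A : Sheaf J GrpCat.{w}
  Pi : Sheaf J GrpCat.{w}
  ρ : A ⟶ Pi
  action : GroupAction Pi A
  ρ_act {U : E} (g : Pi.obj.obj (op U)) (a : A.obj.obj (op U)) :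
    onSec ρ (action.act U g a) = g * onSec ρ a * g⁻¹
  act_ρ {U : E} (a b : A.obj.obj (op U)) : action.act U (onSec ρ a) b = a * b * a⁻¹

namespace CrossedGroupSheaf

variable {J : GrothendieckTopology E}

/-- A morphism `(f, φ)` of sheaves of crossed groups. -/
@[ext] structure Hom (X Y : CrossedGroupSheaf J) where
  f : X.A ⟶ Y.A
  φ : X.Pi ⟶ Y.Pi
  comm : f ≫ Y.ρ = X.ρ ≫ φ
  map_act {U : E} (g : X.Pi.obj.obj (op U)) (a : X.A.obj.obj (op U)) :
    onSec f (X.action.act U g a) = Y.action.act U (onSec φ g) (onSec f a)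

@[simps] instance : Category (CrossedGroupSheaf J) where
  Hom := Hom
  id X := ⟨𝟙 _, 𝟙 _, by rw [Category.id_comp, Category.comp_id], fun _ _ => rfl⟩
  comp m n := ⟨m.f ≫ n.f, m.φ ≫ n.φ, by
      rw [Category.assoc, n.comm, ← Category.assoc, m.comm, Category.assoc],
    fun g a => (congrArg (onSec n.f) (m.map_act g a)).trans (n.map_act _ _)⟩
  id_comp m := Hom.ext (Category.id_comp _) (Category.id_comp _)
  comp_id m := Hom.ext (Category.comp_id _) (Category.comp_id _)
  assoc m n k := Hom.ext (Category.assoc _ _ _) (Category.assoc _ _ _)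

end CrossedGroupSheaf

end CrossedGroups

section Torsc

variable {E : Type u} [Category.{w} E] {J : GrothendieckTopology E}

/-- Objects of the stack of torsors under `H`: torsors under `H|S` on the localized site `E/S`, for
a variable object `S`. -/
structure Torsc (H : Sheaf J GrpCat.{w}) where
  base : E
  torsor : Torsor (J.over base) (H.over base)

namespace Torsc

variable {H H' H'' : Sheaf J GrpCat.{w}}

/-- The underlying sheaf of sets on `E/S`. -/
abbrev slice (P : Torsc H) : SliceSheaf J (Type w) := ⟨P.base, P.torsor.sheaf⟩

/-- The action of the sections of `H` over `U`. -/
abbrev act (P : Torsc H) {U : E} {t : U ⟶ P.base} (p : P.slice.val t) (g : H.obj.obj (op U)) :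
    P.slice.val t := P.torsor.act (U := Over.mk t) p g

end Torsc

variable {H H' H'' : Sheaf J GrpCat.{w}}

/-- A morphism of torsors compatible with `φ : H ⟶ H'`, over a morphism of the bases. -/
structure TorsorHom (φ : H ⟶ H') (P : Torsc H) (P' : Torsc H') where
  hom : P.slice ⟶ P'.slice
  map_act {U : E} (t : U ⟶ P.base) (s : U ⟶ P'.base) (h : t ≫ hom.base = s)
    (p : P.slice.val t) (g : H.obj.obj (op U)) :
    hom.app t s h (P.act p g) = P'.act (hom.app t s h p) (onSec φ g)

theorem TorsorHom.ext {φ : H ⟶ H'} {P : Torsc H} {P' : Torsc H'} {m n : TorsorHom φ P P'}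
    (h : m.hom = n.hom) : m = n := by
  cases m; cases n; cases h; rfl

namespace TorsorHom

/-- The map on sections. -/
abbrev ap {φ : H ⟶ H'} {P : Torsc H} {P' : Torsc H'} (m : TorsorHom φ P P') {U : E}
    (t : U ⟶ P.base) (s : U ⟶ P'.base) (h : t ≫ m.hom.base = s) (p : P.slice.val t) :
    P'.slice.val s := m.hom.app t s h p

theorem ap_res {φ : H ⟶ H'} {P : Torsc H} {P' : Torsc H'} (m : TorsorHom φ P P') {U V : E}
    (u : V ⟶ U) {t : U ⟶ P.base} {s : U ⟶ P'.base} (h : t ≫ m.hom.base = s)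
    {t' : V ⟶ P.base} {s' : V ⟶ P'.base} (h' : t' ≫ m.hom.base = s') (ht : u ≫ t = t')
    (hs : u ≫ s = s') (p : P.slice.val t) :
    P'.slice.valMap u hs (m.ap t s h p) = m.ap t' s' h' (P.slice.valMap u ht p) :=
  (ConcreteCategory.congr_hom (m.hom.naturality u h h' ht hs) p).symm

theorem hom_ext {φ : H ⟶ H'} {P : Torsc H} {P' : Torsc H'} {m n : TorsorHom φ P P'}
    (hb : m.hom.base = n.hom.base) (ha : ∀ {U : E} (t : U ⟶ P.base) (s : U ⟶ P'.base)
      (h : t ≫ m.hom.base = s) (h' : t ≫ n.hom.base = s) (p : P.slice.val t),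
        m.ap t s h p = n.ap t s h' p) : m = n :=
  TorsorHom.ext (SliceSheaf.hom_ext hb fun t s h h' => by
    ext p
    exact ha t s h h' p)

end TorsorHom

/-- The identity. -/
def TorsorHom.id (P : Torsc H) : TorsorHom (𝟙 H) P P where
  hom := 𝟙 _
  map_act t s h p g := by
    obtain rfl : t = s := (Category.comp_id t).symm.trans h
    have e (q : P.slice.val t) : SliceSheaf.Hom.app (𝟙 P.slice) t t h q = q :=
      ConcreteCategory.congr_hom (SliceSheaf.id_app P.slice t h) q
    exact (e _).trans (congrArg (fun q => P.act q g) (e p).symm)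

/-- The composition. -/
def TorsorHom.comp {φ : H ⟶ H'} {ψ : H' ⟶ H''} {χ : H ⟶ H''} (e : φ ≫ ψ = χ) {P : Torsc H}
    {P' : Torsc H'} {P'' : Torsc H''} (m : TorsorHom φ P P') (n : TorsorHom ψ P' P'') :
    TorsorHom χ P P'' where
  hom := m.hom ≫ n.hom
  map_act t s h p g := by
    rw [SliceSheaf.comp_app m.hom n.hom t (t ≫ m.hom.base) s rfl
      ((Category.assoc _ _ _).trans h) h]
    subst e
    exact (congrArg (n.hom.app _ _ _) (m.map_act _ _ _ _ _)).trans (n.map_act _ _ _ _ _)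

instance : Category (Torsc H) where
  Hom P P' := TorsorHom (𝟙 H) P P'
  id P := TorsorHom.id P
  comp m n := TorsorHom.comp (Category.comp_id _) m n
  id_comp m := TorsorHom.ext (Category.id_comp _)
  comp_id m := TorsorHom.ext (Category.comp_id _)
  assoc m n k := TorsorHom.ext (Category.assoc _ _ _)

namespace Torsc

/-- The projection to the base category. -/
@[simps] def proj (H : Sheaf J GrpCat.{w}) : Torsc H ⥤ E where
  obj P := P.base
  map m := m.hom.base

end Torsc

end Torsc

section Extend

variable {C : Type u} [Category.{w} C] {K : GrothendieckTopology C} [IsUSite K]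
  {H H' : Sheaf K GrpCat.{w}} (φ : H ⟶ H') (P : Torsor K H)

theorem res_id (X : Cᵒᵖ ⥤ Type w) {U : C} (x : X.obj (op U)) : res X (𝟙 U) x = x := by
  simp [res]

/-- The right action of `H'` on the contracted product: `(p, a) · h = (p, a h)`. -/
theorem exists_extend_act {U : C} (x : (contracted P (translation φ)).obj.obj (op U))
    (h : H'.obj.obj (op U)) :
    ∃! z : (contracted P (translation φ)).obj.obj (op U),
      ∀ ⦃V : C⦄ (f : V ⟶ U) (p : P.sheaf.obj.obj (op V)),
        res (contracted P (translation φ)).obj f z = gpair P (translation φ) p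
          (gcoord P (translation φ) p (res (contracted P (translation φ)).obj f x) *
            gres H'.obj f h) := by
  refine glue P _ (fun V f p => gpair P (translation φ) p
          (gcoord P (translation φ) p (res (contracted P (translation φ)).obj f x) *
            gres H'.obj f h)) ?_ ?_
  · intro V W g f p
    rw [gpair_res, ← res_res, gcoord_res, map_mul]
    congr 2
    simp [gres]
  · intro V f p g
    rw [gcoord_act, gpair_act]
    congr 1
    refine (mul_assoc (((φ.hom.app (op V)).hom g : H'.obj.obj (op V))) _ _).symm.trans ?_
    exact congrArg (· * gres H'.obj f h) (gsmul_inv_smul (translation φ) _ _)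

/-- The right action of `H'` on the contracted product. -/
noncomputable def extendAct {U : C} (x : (contracted P (translation φ)).obj.obj (op U))
    (h : H'.obj.obj (op U)) : (contracted P (translation φ)).obj.obj (op U) :=
  (exists_extend_act φ P x h).choose

theorem extendAct_res' {U V : C} (f : V ⟶ U) (x : (contracted P (translation φ)).obj.obj (op U))
    (h : H'.obj.obj (op U)) (p : P.sheaf.obj.obj (op V)) :
    res (contracted P (translation φ)).obj f (extendAct φ P x h) = gpair P (translation φ) p
          (gcoord P (translation φ) p (res (contracted P (translation φ)).obj f x) *
            gres H'.obj f h) :=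
  (exists_extend_act φ P x h).choose_spec.1 f p

theorem extendAct_res {U V : C} (f : V ⟶ U) (x : (contracted P (translation φ)).obj.obj (op U))
    (h : H'.obj.obj (op U)) :
    res (contracted P (translation φ)).obj f (extendAct φ P x h) =
      extendAct φ P (res (contracted P (translation φ)).obj f x) (gres H'.obj f h) := by
  refine sep_torsor P _ fun W g p => ?_
  rw [res_res, extendAct_res' φ P _ _ _ p, extendAct_res' φ P _ _ _ p, res_res]
  congr 2
  simp [gres]

theorem extendAct_gpair {U : C} (p : P.sheaf.obj.obj (op U)) (a h : H'.obj.obj (op U)) :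
    extendAct φ P (gpair P (translation φ) p a) h = gpair P (translation φ) p (a * h) := by
  have e := extendAct_res' φ P (𝟙 U) (gpair P (translation φ) p a) h p
  rw [res_id, res_id, gcoord_gpair] at e
  refine e.trans ?_
  congr 2
  simp [gres]

/-- The extension of the structural group of a torsor along `φ`: the contracted product
`P ∧ H'`. -/
noncomputable def extendTorsor : Torsor K H' where
  sheaf := contracted P (translation φ)
  act x h := extendAct φ P x h
  act_one x := by
    refine sep_torsor P _ fun V f p => ?_
    rw [extendAct_res' φ P _ _ _ p, map_one, mul_one, gpair_gcoord]
  act_mul x g h := by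
    refine sep_torsor P _ fun V f p => ?_
    rw [extendAct_res' φ P _ _ _ p, extendAct_res' φ P _ _ _ p, extendAct_res' φ P _ _ _ p,
      gcoord_gpair, map_mul, mul_assoc]
  act_res f x h := extendAct_res φ P f x h
  simply_transitive {U} x y := by
    have hg : ∃! z : (setSheaf H').obj.obj (op U), ∀ ⦃V : C⦄ (f : V ⟶ U)
        (p : P.sheaf.obj.obj (op V)), res (setSheaf H').obj f z =
          (gcoord P (translation φ) p (res (contracted P (translation φ)).obj f x))⁻¹ *
            gcoord P (translation φ) p (res (contracted P (translation φ)).obj f y) := by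
      refine glue P (setSheaf H') (fun V f p =>
        (gcoord P (translation φ) p (res (contracted P (translation φ)).obj f x))⁻¹ *
            gcoord P (translation φ) p (res (contracted P (translation φ)).obj f y)) ?_ ?_
      · intro V W g f p
        refine (map_mul (gres H'.obj g) _ _).trans ?_
        rw [map_inv, ← gcoord_res, ← gcoord_res, res_res, res_res]
      · intro V f p h
        rw [gcoord_act, gcoord_act]
        have e (a : H'.obj.obj (op V)) : gsmul (translation φ) h⁻¹ a =
          (φ.hom.app (op V)).hom h⁻¹ * a := rfl
        rw [e, e]
        rw [mul_inv_rev, mul_assoc, inv_mul_cancel_left]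
    obtain ⟨z, hz, -⟩ := hg
    have hz' : ∀ ⦃V : C⦄ (f : V ⟶ U) (p : P.sheaf.obj.obj (op V)), gres H'.obj f z =
        (gcoord P (translation φ) p (res (contracted P (translation φ)).obj f x))⁻¹ *
            gcoord P (translation φ) p (res (contracted P (translation φ)).obj f y) := hz
    refine ⟨z, ?_, fun z' hz'' => ?_⟩
    · refine sep_torsor P _ fun V f p => ?_
      refine (extendAct_res' φ P f x z p).trans ?_
      rw [hz' f p, mul_inv_cancel_left, gpair_gcoord]
    · refine sep_torsor P (setSheaf H') fun V f p => ?_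
      refine Eq.trans ?_ (hz f p).symm
      have e := extendAct_res' φ P f x z' p
      rw [hz''] at e
      rw [e, gcoord_gpair, inv_mul_cancel_left]
      rfl
  locally_nonempty U := by
    obtain ⟨R, hR, h⟩ := P.locally_nonempty U
    exact ⟨R, hR, fun V f hf => ⟨gpair P (translation φ) (h f hf).some 1⟩⟩

end Extend

section Contract

variable {E : Type u} [Category.{w} E] {J : GrothendieckTopology E}

/-- The restriction of an action to the localized site. -/
def LeftAction.over {H A : Sheaf J GrpCat.{w}} (L : LeftAction H (setSheaf A)) (S : E) :
    LeftAction (H.over S) (setSheaf (A.over S)) where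
  smul {U} g a := L.smul (U := U.left) g a
  one_smul {U} q := L.one_smul (U := U.left) q
  mul_smul {U} g h q := L.mul_smul (U := U.left) g h q
  smul_res f g q := L.smul_res f.left g q

/-- The restriction of an action to the localized site. -/
def GroupAction.over {H A : Sheaf J GrpCat.{w}} (L : GroupAction H A) (S : E) :
    GroupAction (H.over S) (A.over S) where
  act U := L.act U.left
  act_res f g q := L.act_res f.left g q

/-- The restriction of a morphism to the localized site. -/
abbrev overMap {H H' : Sheaf J GrpCat.{w}} (φ : H ⟶ H') (S : E) : H.over S ⟶ H'.over S :=
  (J.overPullback GrpCat.{w} S).map φ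

/-- Descent along a torsor, over a morphism of the bases. -/
theorem slice_glue {H : Sheaf J GrpCat.{w}} (P : Torsc H) (X : SliceSheaf J (Type w))
    (f : P.base ⟶ X.base) {U : E} (t : U ⟶ P.base) (s : U ⟶ X.base) (h : t ≫ f = s)
    (e : ∀ ⦃V : E⦄ (u : V ⟶ U) (t' : V ⟶ P.base) (s' : V ⟶ X.base) (_ : u ≫ t = t')
      (_ : u ≫ s = s'), P.slice.val t' → X.val s')
    (e_res : ∀ ⦃V W : E⦄ (u : V ⟶ U) (t' : V ⟶ P.base) (s' : V ⟶ X.base) (ht : u ≫ t = t')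
      (hs : u ≫ s = s') (v : W ⟶ V) (t'' : W ⟶ P.base) (s'' : W ⟶ X.base) (ht' : v ≫ t' = t'')
      (hs' : v ≫ s' = s'') (p : P.slice.val t'), X.valMap v hs' (e u t' s' ht hs p) =
        e (v ≫ u) t'' s'' (by rw [Category.assoc, ht, ht']) (by rw [Category.assoc, hs, hs'])
          (P.slice.valMap v ht' p))
    (e_act : ∀ ⦃V : E⦄ (u : V ⟶ U) (t' : V ⟶ P.base) (s' : V ⟶ X.base) (ht : u ≫ t = t')
      (hs : u ≫ s = s') (p : P.slice.val t') (g : H.obj.obj (op V)),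
        e u t' s' ht hs (P.act p g) = e u t' s' ht hs p) :
    ∃! z : X.val s, ∀ ⦃V : E⦄ (u : V ⟶ U) (t' : V ⟶ P.base) (s' : V ⟶ X.base)
      (ht : u ≫ t = t') (hs : u ≫ s = s') (p : P.slice.val t'),
        X.valMap u hs z = e u t' s' ht hs p := by
  subst h
  have key := glue P.torsor ((J.overMapPullback (Type w) f).obj X.sheaf) (U := Over.mk t)
    (fun V u p => e u.left V.hom (V.hom ≫ f) (Over.w u)
      (by rw [← Category.assoc]; exact congrArg (· ≫ f) (Over.w u)) p) ?_ ?_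
  · obtain ⟨z, hz, hz'⟩ := key
    refine ⟨z, ?_, ?_⟩
    · intro V u t' s' ht hs p
      obtain rfl : t' ≫ f = s' := by rw [← ht, ← hs, Category.assoc]
      exact hz (Over.homMk u ht : Over.mk t' ⟶ Over.mk t) p
    · intro y hy
      refine hz' y fun V u p => ?_
      exact hy u.left V.hom (V.hom ≫ f) _ _ p
  · intro V W v u p
    exact e_res u.left V.hom (V.hom ≫ f) _ _ v.left W.hom (W.hom ≫ f) (Over.w v)
      (by rw [← Category.assoc]; exact congrArg (· ≫ f) (Over.w v)) p
  · intro V u p g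
    exact e_act _ _ _ _ _ p g

/-- Equality of sections may be tested where the torsor has a section. -/
theorem slice_sep {H : Sheaf J GrpCat.{w}} (P : Torsc H) (X : SliceSheaf J (Type w))
    (f : P.base ⟶ X.base) {U : E} (t : U ⟶ P.base) (s : U ⟶ X.base) (h : t ≫ f = s)
    {x y : X.val s} (hxy : ∀ ⦃V : E⦄ (u : V ⟶ U) (t' : V ⟶ P.base) (s' : V ⟶ X.base)
      (_ : u ≫ t = t') (hs : u ≫ s = s') (_ : P.slice.val t'),
        X.valMap u hs x = X.valMap u hs y) : x = y := by
  subst h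
  refine sep_torsor P.torsor ((J.overMapPullback (Type w) f).obj X.sheaf) (U := Over.mk t)
    (x := x) (y := y) fun V u p => ?_
  exact hxy u.left V.hom (V.hom ≫ f) (Over.w u)
      (by rw [← Category.assoc]; exact congrArg (· ≫ f) (Over.w u)) p

variable [IsUSite J]

/-- The contracted product on the localized site, with a sheaf of groups defined on the
whole site. -/
noncomputable abbrev cslice {H A : Sheaf J GrpCat.{w}} (P : Torsc H)
    (L : LeftAction H (setSheaf A)) : SliceSheaf J (Type w) :=
  ⟨P.base, contracted P.torsor (L.over P.base)⟩

section

variable {H A : Sheaf J GrpCat.{w}} {P : Torsc H} {L : LeftAction H (setSheaf A)}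

/-- The class of `(p, a)`. -/
noncomputable abbrev spair (P : Torsc H) (L : LeftAction H (setSheaf A)) {U : E} {t : U ⟶ P.base}
    (p : P.slice.val t) (a : A.obj.obj (op U)) : (cslice P L).val t :=
  gpair P.torsor (L.over P.base) (U := Over.mk t) p a

/-- The inverse of `a ↦ (p, a)`. -/
noncomputable abbrev scoord (P : Torsc H) (L : LeftAction H (setSheaf A)) {U : E} {t : U ⟶ P.base}
    (p : P.slice.val t) (x : (cslice P L).val t) : A.obj.obj (op U) :=
  gcoord P.torsor (L.over P.base) (U := Over.mk t) p x

theorem spair_res {U V : E} (u : V ⟶ U) {t : U ⟶ P.base} {t' : V ⟶ P.base} (ht : u ≫ t = t')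
    (p : P.slice.val t) (a : A.obj.obj (op U)) :
    (cslice P L).valMap u ht (spair P L p a) =
      spair P L (P.slice.valMap u ht p) (gres A.obj u a) :=
  gpair_res P.torsor (L.over P.base) (Over.homMk u ht : Over.mk t' ⟶ Over.mk t) p a

theorem scoord_res {U V : E} (u : V ⟶ U) {t : U ⟶ P.base} {t' : V ⟶ P.base} (ht : u ≫ t = t')
    (p : P.slice.val t) (x : (cslice P L).val t) :
    scoord P L (P.slice.valMap u ht p) ((cslice P L).valMap u ht x) =
      gres A.obj u (scoord P L p x) :=
  gcoord_res P.torsor (L.over P.base) (Over.homMk u ht : Over.mk t' ⟶ Over.mk t) p x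

theorem spair_act {U : E} {t : U ⟶ P.base} (p : P.slice.val t) (g : H.obj.obj (op U))
    (a : A.obj.obj (op U)) : spair P L (P.act p g) a = spair P L p (gsmul L g a) :=
  gpair_act P.torsor (L.over P.base) (U := Over.mk t) p g a

theorem scoord_act {U : E} {t : U ⟶ P.base} (p : P.slice.val t) (g : H.obj.obj (op U))
    (x : (cslice P L).val t) : scoord P L (P.act p g) x = gsmul L g⁻¹ (scoord P L p x) :=
  gcoord_act P.torsor (L.over P.base) (U := Over.mk t) p g x

theorem spair_scoord {U : E} {t : U ⟶ P.base} (p : P.slice.val t) (x : (cslice P L).val t) :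
    spair P L p (scoord P L p x) = x := gpair_gcoord _ _ _ _

theorem scoord_spair {U : E} {t : U ⟶ P.base} (p : P.slice.val t) (a : A.obj.obj (op U)) :
    scoord P L p (spair P L p a) = a := gcoord_gpair _ _ _ _

end

theorem valMap_valMap (X : SliceSheaf J (Type w)) {U V W : E} (u : V ⟶ U) (v : W ⟶ V)
    {t : U ⟶ X.base} {t' : V ⟶ X.base} {t'' : W ⟶ X.base} (ht : u ≫ t = t') (ht' : v ≫ t' = t'')
    (x : X.val t) : X.valMap v ht' (X.valMap u ht x) =
      X.valMap (v ≫ u) (by rw [Category.assoc, ht, ht']) x :=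
  res_res X.sheaf.obj (Over.homMk v ht' : Over.mk t'' ⟶ Over.mk t')
    (Over.homMk u ht : Over.mk t' ⟶ Over.mk t) x

section ContractMap

variable {H H' A A' : Sheaf J GrpCat.{w}} {φ : H ⟶ H'} (k : A ⟶ A')
  {L : LeftAction H (setSheaf A)} {L' : LeftAction H' (setSheaf A')}
  {P : Torsc H} {P' : Torsc H'}

/-- The map `(p, a) ↦ (m p, k a)` between contracted products. -/
theorem exists_contractMap
    (hk : ∀ {U : E} (g : H.obj.obj (op U)) (a : A.obj.obj (op U)),
      onSec k (gsmul L g a) = gsmul L' (onSec φ g) (onSec k a)) (m : TorsorHom φ P P')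
    {U : E} (t : U ⟶ P.base) (s : U ⟶ P'.base) (h : t ≫ m.hom.base = s)
    (x : (cslice P L).val t) :
    ∃! z : (cslice P' L').val s, ∀ ⦃V : E⦄ (u : V ⟶ U) (t' : V ⟶ P.base) (s' : V ⟶ P'.base)
      (ht : u ≫ t = t') (hs : u ≫ s = s') (p : P.slice.val t'),
        (cslice P' L').valMap u hs z = spair P' L' (m.ap t' s' (by rw [← ht, ← hs, ← h,
          Category.assoc]) p) (onSec k (scoord P L p ((cslice P L).valMap u ht x))) := by
  refine slice_glue P (cslice P' L') m.hom.base t s h (fun V u t' s' ht hs p =>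
    spair P' L' (m.ap t' s' (by rw [← ht, ← hs, ← h,
          Category.assoc]) p) (onSec k (scoord P L p ((cslice P L).valMap u ht x)))) ?_ ?_
  · intro V W u t' s' ht hs v t'' s'' ht' hs' p
    rw [spair_res, m.ap_res v _ _ ht', ← valMap_valMap _ u v ht ht', scoord_res, hom_gres]
  · intro V u t' s' ht hs p g
    have e : m.ap t' s' (by rw [← ht, ← hs, ← h, Category.assoc]) (P.act p g) = _ :=
      m.map_act t' s' _ p g
    rw [e, spair_act, scoord_act, ← hk, gsmul_inv_smul]

theorem valMap_id (X : SliceSheaf J (Type w)) {U : E} {t : U ⟶ X.base} (ht : 𝟙 U ≫ t = t)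
    (x : X.val t) : X.valMap (𝟙 U) ht x = x :=
  ConcreteCategory.congr_hom (X.sheaf.obj.map_id (op (Over.mk t))) x

/-- The map `(p, a) ↦ (m p, k a)` between contracted products. -/
noncomputable def contractFun
    (hk : ∀ {U : E} (g : H.obj.obj (op U)) (a : A.obj.obj (op U)),
      onSec k (gsmul L g a) = gsmul L' (onSec φ g) (onSec k a)) (m : TorsorHom φ P P')
    {U : E} (t : U ⟶ P.base) (s : U ⟶ P'.base)
    (h : t ≫ m.hom.base = s) (x : (cslice P L).val t) : (cslice P' L').val s :=
  (exists_contractMap k hk m t s h x).choose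

theorem contractFun_spec
    (hk : ∀ {U : E} (g : H.obj.obj (op U)) (a : A.obj.obj (op U)),
      onSec k (gsmul L g a) = gsmul L' (onSec φ g) (onSec k a)) (m : TorsorHom φ P P')
    {U : E} (t : U ⟶ P.base) (s : U ⟶ P'.base) (h : t ≫ m.hom.base = s)
    (x : (cslice P L).val t) {V : E} (u : V ⟶ U) (t' : V ⟶ P.base) (s' : V ⟶ P'.base)
    (ht : u ≫ t = t') (hs : u ≫ s = s') (h' : t' ≫ m.hom.base = s') (p : P.slice.val t') :
    (cslice P' L').valMap u hs (contractFun k hk m t s h x) = spair P' L' (m.ap t' s' h' p)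
      (onSec k (scoord P L p ((cslice P L).valMap u ht x))) :=
  (exists_contractMap k hk m t s h x).choose_spec.1 u t' s' ht hs p

theorem contractFun_res
    (hk : ∀ {U : E} (g : H.obj.obj (op U)) (a : A.obj.obj (op U)),
      onSec k (gsmul L g a) = gsmul L' (onSec φ g) (onSec k a)) (m : TorsorHom φ P P')
    {U V : E} (u : V ⟶ U) {t : U ⟶ P.base} {s : U ⟶ P'.base}
    (h : t ≫ m.hom.base = s) {t' : V ⟶ P.base} {s' : V ⟶ P'.base} (h' : t' ≫ m.hom.base = s')
    (ht : u ≫ t = t') (hs : u ≫ s = s') (x : (cslice P L).val t) :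
    contractFun k hk m t' s' h' ((cslice P L).valMap u ht x) =
      (cslice P' L').valMap u hs (contractFun k hk m t s h x) := by
  refine slice_sep P (cslice P' L') m.hom.base t' s' h' fun W v t'' s'' ht' hs' p => ?_
  have h'' : t'' ≫ m.hom.base = s'' := by rw [← ht', ← hs', ← h', Category.assoc]
  rw [contractFun_spec k hk m t' s' h' _ v t'' s'' ht' hs' h'' p, valMap_valMap, valMap_valMap,
    contractFun_spec k hk m t s h _ (v ≫ u) t'' s'' _ _ h'' p]

theorem contractFun_spair
    (hk : ∀ {U : E} (g : H.obj.obj (op U)) (a : A.obj.obj (op U)),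
      onSec k (gsmul L g a) = gsmul L' (onSec φ g) (onSec k a)) (m : TorsorHom φ P P')
    {U : E} (t : U ⟶ P.base) (s : U ⟶ P'.base) (h : t ≫ m.hom.base = s)
    (p : P.slice.val t) (a : A.obj.obj (op U)) :
    contractFun k hk m t s h (spair P L p a) = spair P' L' (m.ap t s h p) (onSec k a) := by
  have e := contractFun_spec k hk m t s h (spair P L p a) (𝟙 U) t s (Category.id_comp t)
    (Category.id_comp s) h p
  rw [valMap_id, valMap_id, scoord_spair] at e
  exact e

end ContractMap

/-- Morphisms out of a contracted product are determined on the classes `(p, a)`. -/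
theorem contractFun_ext {H A : Sheaf J GrpCat.{w}} {L : LeftAction H (setSheaf A)} {P : Torsc H}
    {X : SliceSheaf J (Type w)} {m n : cslice P L ⟶ X} (hb : m.base = n.base)
    (ha : ∀ {U : E} (t : U ⟶ P.base) (s : U ⟶ X.base) (h : t ≫ m.base = s) (h' : t ≫ n.base = s)
      (p : P.slice.val t) (a : A.obj.obj (op U)),
        m.app t s h (spair P L p a) = n.app t s h' (spair P L p a)) : m = n := by
  refine SliceSheaf.hom_ext hb fun t s h h' => ?_
  ext x
  refine slice_sep P X m.base t s h fun V u t' s' ht hs p => ?_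
  have hm : t' ≫ m.base = s' := by rw [← ht, ← hs, ← h, Category.assoc]
  have hn : t' ≫ n.base = s' := by rw [← ht, ← hs, ← h', Category.assoc]
  refine (ConcreteCategory.congr_hom (m.naturality u h hm ht hs) x).symm.trans ?_
  refine Eq.trans ?_ (ConcreteCategory.congr_hom (n.naturality u h' hn ht hs) x)
  have e := spair_scoord p ((cslice P L).valMap u ht x)
  have := ha t' s' hm hn p (scoord P L p ((cslice P L).valMap u ht x))
  rw [e] at this
  exact this

section Twist

variable {H H' A A' : Sheaf J GrpCat.{w}} {φ : H ⟶ H'}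

/-- The sheaf of groups `P ∧ A` on the localized site. -/
noncomputable abbrev tslice (P : Torsc H) (L : GroupAction H A) : FAGRSC J :=
  ⟨P.base, twist P.torsor (L.over P.base)⟩

/-- The class of `(p, a)` in `P ∧ A`. -/
noncomputable abbrev tpair (P : Torsc H) (L : GroupAction H A) {U : E} {t : U ⟶ P.base}
    (p : P.slice.val t) (a : A.obj.obj (op U)) : (tslice P L).val t :=
  spair P L.toLeft p a

theorem tpair_mul {P : Torsc H} {L : GroupAction H A} {U : E} {t : U ⟶ P.base}
    (p : P.slice.val t) (a b : A.obj.obj (op U)) :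
    tpair P L p (a * b) = tpair P L p a * tpair P L p b :=
  gpair_mul P.torsor (L.over P.base) (U := Over.mk t) p a b

variable (k : A ⟶ A') {L : GroupAction H A} {L' : GroupAction H' A'}
  (hk : ∀ {U : E} (g : H.obj.obj (op U)) (a : A.obj.obj (op U)),
    onSec k (L.act U g a) = L'.act U (onSec φ g) (onSec k a))
  {P : Torsc H} {P' : Torsc H'} (m : TorsorHom φ P P')

/-- The map `(p, a) ↦ (m p, k a)` from `P ∧ A` to `P' ∧ A'`. -/
noncomputable def twistHom : tslice P L ⟶ tslice P' L' where
  base := m.hom.base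
  app {U} t s h := GrpCat.ofHom (MonoidHom.mk'
    (fun x : (tslice P L).val t => (contractFun (L := L.toLeft) (L' := L'.toLeft) k hk m t s h x :
      (tslice P' L').val s)) (by
      intro x y
      refine slice_sep P (cslice P' L'.toLeft) m.hom.base t s h fun W v t' s' ht hs p => ?_
      have h' : t' ≫ m.hom.base = s' := by rw [← ht, ← hs, ← h, Category.assoc]
      have e₁ (x y : (tslice P L).val t) := map_mul ((tslice P L).valMap v ht).hom x y
      have e₂ (x y : (tslice P' L').val s) := map_mul ((tslice P' L').valMap v hs).hom x y
      refine Eq.trans ?_ (e₂ _ _).symm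
      have spec := fun z => contractFun_spec (L := L.toLeft) (L' := L'.toLeft) k hk m t s h z
        v t' s' ht hs h' p
      refine (spec _).trans ?_
      refine Eq.trans ?_ (congrArg₂ (fun a b : (tslice P' L').val s' => a * b)
        (spec _) (spec _)).symm
      refine Eq.trans ?_ (tpair_mul (L := L') _ _ _)
      congr 1
      rw [← map_mul]
      congr 1
      refine gpair_injective P.torsor (L.over P.base).toLeft (U := Over.mk t') p ?_
      refine (spair_scoord (L := L.toLeft) p _).trans ?_
      refine (e₁ x y).trans ?_
      refine Eq.trans ?_ (tpair_mul (L := L) _ _ _).symm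
      exact (congrArg₂ (fun a b : (tslice P L).val t' => a * b)
        (spair_scoord (L := L.toLeft) p _) (spair_scoord (L := L.toLeft) p _)).symm))
  naturality u t s h t' s' h' ht hs := by
    refine GrpCat.hom_ext (MonoidHom.ext fun x => ?_)
    exact contractFun_res (L := L.toLeft) (L' := L'.toLeft) k hk m u h h' ht hs x

theorem twistHom_tpair {U : E} (t : U ⟶ P.base) (s : U ⟶ P'.base) (h : t ≫ m.hom.base = s)
    (p : P.slice.val t) (a : A.obj.obj (op U)) :
    (twistHom k hk m).app t s h (tpair P L p a) = tpair P' L' (m.ap t s h p) (onSec k a) :=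
  contractFun_spair (L := L.toLeft) (L' := L'.toLeft) k hk m t s h p a

/-- Morphisms out of `P ∧ A` are determined on the classes `(p, a)`. -/
theorem tslice_hom_ext {X : FAGRSC J} {m n : tslice P L ⟶ X} (hb : m.base = n.base)
    (ha : ∀ {U : E} (t : U ⟶ P.base) (s : U ⟶ X.base) (h : t ≫ m.base = s) (h' : t ≫ n.base = s)
      (p : P.slice.val t) (a : A.obj.obj (op U)),
        m.app t s h (tpair P L p a) = n.app t s h' (tpair P L p a)) : m = n := by
  refine SliceSheaf.hom_ext hb fun t s h h' => ?_
  refine GrpCat.hom_ext (MonoidHom.ext fun x => ?_)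
  refine slice_sep P ⟨X.base, setSheaf X.sheaf⟩ m.base t s h fun V u t' s' ht hs p => ?_
  have hm : t' ≫ m.base = s' := by rw [← ht, ← hs, ← h, Category.assoc]
  have hn : t' ≫ n.base = s' := by rw [← ht, ← hs, ← h', Category.assoc]
  refine (ConcreteCategory.congr_hom (m.naturality u h hm ht hs) x).symm.trans ?_
  refine Eq.trans ?_ (ConcreteCategory.congr_hom (n.naturality u h' hn ht hs) x)
  have e := spair_scoord p ((cslice P L.toLeft).valMap u ht x)
  have := ha t' s' hm hn p (scoord P L.toLeft p ((cslice P L.toLeft).valMap u ht x))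
  rw [tpair, e] at this
  exact this

end Twist

end Contract

section Functors

variable {E : Type u} [Category.{w} E] {J : GrothendieckTopology E} [IsUSite J]

theorem CrossedGroupSheaf.Hom.map_act' {X Y : CrossedGroupSheaf J} (F : X ⟶ Y) {U : E}
    (g : X.Pi.obj.obj (op U)) (a : X.A.obj.obj (op U)) :
    onSec F.f (X.action.act U g a) = Y.action.act U (onSec F.φ g) (onSec F.f a) :=
  CrossedGroupSheaf.Hom.map_act F g a

theorem SliceSheaf.comp_app_type {X Y Z : SliceSheaf J (Type w)} (m : X ⟶ Y) (n : Y ⟶ Z) {U : E}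
    (t : U ⟶ X.base) (s : U ⟶ Y.base) (r : U ⟶ Z.base) (h : t ≫ m.base = s)
    (h' : s ≫ n.base = r) (h'' : t ≫ (m ≫ n).base = r) (x : X.val t) :
    (m ≫ n).app t r h'' x = n.app s r h' (m.app t s h x) :=
  ConcreteCategory.congr_hom (SliceSheaf.comp_app m n t s r h h' h'') x

theorem SliceSheaf.comp_app_grp {X Y Z : FAGRSC J} (m : X ⟶ Y) (n : Y ⟶ Z) {U : E}
    (t : U ⟶ X.base) (s : U ⟶ Y.base) (r : U ⟶ Z.base) (h : t ≫ m.base = s)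
    (h' : s ≫ n.base = r) (h'' : t ≫ (m ≫ n).base = r) (x : X.val t) :
    (m ≫ n).app t r h'' x = n.app s r h' (m.app t s h x) :=
  ConcreteCategory.congr_hom (SliceSheaf.comp_app m n t s r h h' h'') x

/-- The map `P ∧ A ⟶ Q ∧ A` induced by a morphism of torsors `P ⟶ Q`. -/
noncomputable def contractMap (X : CrossedGroupSheaf J) {P Q : Torsc X.Pi} (m : P ⟶ Q) :
    tslice P X.action ⟶ tslice Q X.action :=
  twistHom (φ := 𝟙 X.Pi) (𝟙 X.A) (fun _ _ => rfl) m

theorem contractMap_tpair (X : CrossedGroupSheaf J) {P Q : Torsc X.Pi} (m : P ⟶ Q) {U : E}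
    (t : U ⟶ P.base) (s : U ⟶ Q.base) (h : t ≫ m.hom.base = s) (p : P.slice.val t)
    (a : X.A.obj.obj (op U)) : (contractMap X m).app t s h (tpair P X.action p a) =
      tpair Q X.action (m.ap t s h p) a :=
  twistHom_tpair (φ := 𝟙 X.Pi) (𝟙 X.A) (fun _ _ => rfl) m t s h p a

/-- The functor `P ↦ P ∧ A` on torsors under `Π`. -/
noncomputable def contract (X : CrossedGroupSheaf J) : Torsc X.Pi ⥤ FAGRSC J where
  obj P := tslice P X.action
  map m := contractMap X m
  map_id P := by
    refine tslice_hom_ext rfl fun t s h h' p a => ?_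
    obtain rfl : t = s := (Category.comp_id t).symm.trans h
    refine (contractMap_tpair X (𝟙 P) t t h p a).trans
      (Eq.trans ?_ (ConcreteCategory.congr_hom (SliceSheaf.id_app (tslice P X.action) t h')
        (tpair P X.action p a)).symm)
    exact congrArg (fun q => tpair P X.action q a)
      (ConcreteCategory.congr_hom (SliceSheaf.id_app P.slice t h) p)
  map_comp {P Q R} m n := by
    refine tslice_hom_ext rfl fun t s h h' p a => ?_
    have e : (t ≫ m.hom.base) ≫ n.hom.base = s := (Category.assoc _ _ _).trans h
    refine (contractMap_tpair X (m ≫ n) t s h p a).trans ?_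
    refine Eq.trans ?_ (SliceSheaf.comp_app_grp (contractMap X m) (contractMap X n)
      t (t ≫ m.hom.base) s rfl e h' _).symm
    refine Eq.trans ?_ (congrArg ((contractMap X n).app _ s e)
      (contractMap_tpair X m t (t ≫ m.hom.base) rfl p a)).symm
    refine Eq.trans ?_ (contractMap_tpair X n _ s e _ _).symm
    exact congrArg (fun q => tpair R X.action q a)
      (SliceSheaf.comp_app_type m.hom n.hom t (t ≫ m.hom.base) s rfl e h p)

variable {H H' : Sheaf J GrpCat.{w}}

/-- The `H'`-torsor `P ∧ H'` on the localized site. -/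
noncomputable abbrev extend (φ : H ⟶ H') (P : Torsc H) : Torsc H' :=
  ⟨P.base, extendTorsor (overMap φ P.base) P.torsor⟩

theorem extend_act (φ : H ⟶ H') (P : Torsc H) {U : E} {t : U ⟶ P.base} (p : P.slice.val t)
    (a g : H'.obj.obj (op U)) :
    (extend φ P).act (spair P (translation φ) p a : (extend φ P).slice.val t) g =
      spair P (translation φ) p (a * g) :=
  extendAct_gpair (overMap φ P.base) P.torsor (U := Over.mk t) p a g

/-- The map `P ∧ H' ⟶ Q ∧ H'` induced by a morphism of torsors `P ⟶ Q`. -/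
noncomputable def extendMap (φ : H ⟶ H') {P Q : Torsc H} (m : P ⟶ Q) :
    extend φ P ⟶ extend φ Q where
  hom :=
    { base := m.hom.base
      app := fun t s h => ↾ (contractFun (φ := 𝟙 H) (L := translation φ) (L' := translation φ)
        (𝟙 H') (fun _ _ => rfl) m t s h)
      naturality := fun u t s h t' s' h' ht hs => by
        ext x
        exact contractFun_res (φ := 𝟙 H) (L := translation φ) (L' := translation φ)
          (𝟙 H') (fun _ _ => rfl) m u h h' ht hs x }
  map_act {U} t s h x g := by
    refine slice_sep P (cslice Q (translation φ)) m.hom.base t s h fun V u t' s' ht hs p => ?_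
    have h' : t' ≫ m.hom.base = s' := by rw [← ht, ← hs, ← h, Category.assoc]
    have r₁ (y : (cslice P (translation φ)).val t) :=
      contractFun_res (φ := 𝟙 H) (L := translation φ) (L' := translation φ)
          (𝟙 H') (fun _ _ => rfl) m u h h' ht hs y
    refine (r₁ _).symm.trans ?_
    refine Eq.trans ?_ ((extend φ Q).torsor.act_res
      (Over.homMk u hs : Over.mk s' ⟶ Over.mk s) _ g).symm
    refine Eq.trans (congrArg _ ((extend φ P).torsor.act_res
      (Over.homMk u ht : Over.mk t' ⟶ Over.mk t) x g)) ?_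
    refine Eq.trans ?_ (congrArg (fun y => (extend φ Q).act (t := s') y (gres H'.obj u g)) (r₁ x))
    obtain ⟨a, ha⟩ : ∃ a, (cslice P (translation φ)).valMap u ht x =
      spair P (translation φ) p a := ⟨_, (spair_scoord (L := translation φ) p _).symm⟩
    have c (b : H'.obj.obj (op V)) := contractFun_spair (φ := 𝟙 H) (L := translation φ)
      (L' := translation φ) (𝟙 H') (fun _ _ => rfl) m t' s' h' p b
    refine (congrArg (fun y => contractFun (φ := 𝟙 H) (L := translation φ) (L' := translation φ)
        (𝟙 H') (fun _ _ => rfl) m t' s' h' ((extend φ P).act (t := t') y (gres H'.obj u g)))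
          ha).trans ?_
    refine Eq.trans ?_ (congrArg (fun y => (extend φ Q).act (t := s')
      (contractFun (φ := 𝟙 H) (L := translation φ) (L' := translation φ)
        (𝟙 H') (fun _ _ => rfl) m t' s' h' y) (gres H'.obj u g)) ha).symm
    refine (congrArg (contractFun (φ := 𝟙 H) (L := translation φ) (L' := translation φ)
        (𝟙 H') (fun _ _ => rfl) m t' s' h') (extend_act φ P p a _)).trans ?_
    refine (c _).trans ?_
    refine Eq.trans ?_ (congrArg (fun y => (extend φ Q).act (t := s') y (gres H'.obj u g))
      (c a)).symm
    exact (extend_act φ Q _ _ _).symm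

theorem extendMap_spair (φ : H ⟶ H') {P Q : Torsc H} (m : P ⟶ Q) {U : E} (t : U ⟶ P.base)
    (s : U ⟶ Q.base) (h : t ≫ m.hom.base = s) (p : P.slice.val t) (a : H'.obj.obj (op U)) :
    (extendMap φ m).hom.app t s h (spair P (translation φ) p a) =
      spair Q (translation φ) (m.ap t s h p) a :=
  contractFun_spair (φ := 𝟙 H) (L := translation φ) (L' := translation φ)
        (𝟙 H') (fun _ _ => rfl) m t s h p a

/-- Extension of the structural group along `φ`, as a functor `P ↦ P ∧ H'`. -/
noncomputable def extendFunctor (φ : H ⟶ H') : Torsc H ⥤ Torsc H' where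
  obj P := extend φ P
  map m := extendMap φ m
  map_id P := by
    refine TorsorHom.ext (contractFun_ext (P := P) (L := translation φ) rfl
      fun t s h h' p a => ?_)
    obtain rfl : t = s := (Category.comp_id t).symm.trans h
    refine (extendMap_spair φ (𝟙 P) t t h p a).trans (Eq.trans ?_ (ConcreteCategory.congr_hom
      (SliceSheaf.id_app (extend φ P).slice t h') (spair P (translation φ) p a)).symm)
    exact congrArg (fun q => spair P (translation φ) q a)
      (ConcreteCategory.congr_hom (SliceSheaf.id_app P.slice t h) p)
  map_comp {P Q R} m n := by
    refine TorsorHom.ext (contractFun_ext (P := P) (L := translation φ) rfl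
      fun t s h h' p a => ?_)
    have e : (t ≫ m.hom.base) ≫ n.hom.base = s := (Category.assoc _ _ _).trans h
    refine (extendMap_spair φ (m ≫ n) t s h p a).trans ?_
    refine Eq.trans ?_ (SliceSheaf.comp_app_type (extendMap φ m).hom (extendMap φ n).hom
      t (t ≫ m.hom.base) s rfl e h' _).symm
    refine Eq.trans ?_ (congrArg ((extendMap φ n).hom.app _ s e)
      (extendMap_spair φ m t (t ≫ m.hom.base) rfl p a)).symm
    refine Eq.trans ?_ (extendMap_spair φ n _ s e _ _).symm
    exact congrArg (fun q => spair R (translation φ) q a)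
      (SliceSheaf.comp_app_type m.hom n.hom t (t ≫ m.hom.base) s rfl e h p)

/-- The canonical morphism `P ⟶ P ∧ H'`, `p ↦ (p, 1)`, of torsors compatible with `φ`. -/
noncomputable def toExtend (φ : H ⟶ H') (P : Torsc H) : TorsorHom φ P (extend φ P) where
  hom :=
    { base := 𝟙 P.base
      app := fun {U} t s h => ↾ (fun p => spair P (translation φ)
        (P.slice.valMap (𝟙 U) (by simpa using h) p : P.slice.val s) 1)
      naturality := fun {U V} u t s h t' s' h' ht hs => by
        ext p
        obtain rfl : t = s := (Category.comp_id t).symm.trans h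
        obtain rfl : t' = s' := (Category.comp_id t').symm.trans h'
        refine Eq.trans ?_ (spair_res (L := translation φ) u hs _ _).symm
        rw [map_one, valMap_valMap]
        exact congrArg (fun q => spair P (translation φ) q 1)
          ((valMap_id _ _ _).trans
            (congrArg (fun k => P.torsor.sheaf.obj.map k p) (by congr 2; simp))) }
  map_act {U} t s h p g := by
    obtain rfl : t = s := (Category.comp_id t).symm.trans h
    have e : P.slice.valMap (𝟙 U) (Category.id_comp t) (P.act p g) =
      P.act (P.slice.valMap (𝟙 U) (Category.id_comp t) p) g := by rw [valMap_id, valMap_id]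
    refine (congrArg (fun q => spair P (translation φ) q 1) e).trans ?_
    refine (spair_act _ _ _).trans ?_
    refine Eq.trans ?_ (extend_act φ P _ _ _).symm
    rw [one_mul]
    exact congrArg (spair P (translation φ) _) (mul_one _)

theorem toExtend_ap (φ : H ⟶ H') (P : Torsc H) {U : E} (t : U ⟶ P.base)
    (h : t ≫ 𝟙 P.base = t) (p : P.slice.val t) :
    (toExtend φ P).ap t t h p = spair P (translation φ) p 1 :=
  congrArg (fun q => spair P (translation φ) q 1) (valMap_id _ _ _)

/-- The natural map `P ∧ A ⟶ (P ∧ Π') ∧ A'`, `(p, a) ↦ ((p, 1), f a)`. -/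
noncomputable def extendContractApp {X Y : CrossedGroupSheaf J} (F : X ⟶ Y) (P : Torsc X.Pi) :
    tslice P X.action ⟶ tslice (extend F.φ P) Y.action :=
  twistHom F.f F.map_act' (toExtend F.φ P)

theorem extendContractApp_tpair {X Y : CrossedGroupSheaf J} (F : X ⟶ Y) (P : Torsc X.Pi) {U : E}
    (t : U ⟶ P.base) (h : t ≫ 𝟙 P.base = t) (p : P.slice.val t) (a : X.A.obj.obj (op U)) :
    (extendContractApp F P).app t t h (tpair P X.action p a) =
      tpair (extend F.φ P) Y.action (spair P (translation F.φ) p 1) (onSec F.f a) :=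
  (twistHom_tpair F.f F.map_act' (toExtend F.φ P) t t h p a).trans
    (congrArg (fun q => tpair (extend F.φ P) Y.action q (onSec F.f a)) (toExtend_ap F.φ P t h p))

/-- The natural transformation `P ∧ A ⟶ (P ∧ Π') ∧ A'`, `(p, a) ↦ ((p, 1), f a)`. -/
noncomputable def extendContract {X Y : CrossedGroupSheaf J} (F : X ⟶ Y) :
    contract X ⟶ extendFunctor F.φ ⋙ contract Y where
  app P := extendContractApp F P
  naturality P Q m := by
    refine tslice_hom_ext ((Category.comp_id _).trans (Category.id_comp _).symm)
      fun {U} t s h h' p a => ?_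
    obtain rfl : t ≫ m.hom.base = s := (congrArg (t ≫ ·) (Category.comp_id m.hom.base)).symm.trans h
    refine (SliceSheaf.comp_app_grp (contractMap X m) (extendContractApp F Q) t _ _ rfl
      (Category.comp_id _) h _).trans ?_
    refine Eq.trans ?_ (SliceSheaf.comp_app_grp (extendContractApp F P)
      (contractMap Y (extendMap F.φ m)) t t _ (Category.comp_id t) rfl h' _).symm
    refine (congrArg ((extendContractApp F Q).app _ _ (Category.comp_id _))
      (contractMap_tpair X m t _ rfl p a)).trans ?_
    refine (extendContractApp_tpair _ _ _ _ _ _).trans ?_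
    refine Eq.trans ?_ (congrArg ((contractMap Y (extendMap F.φ m)).app t _ rfl)
      (extendContractApp_tpair F P t (Category.comp_id t) p a)).symm
    refine Eq.trans ?_ (contractMap_tpair Y (extendMap F.φ m) t _ rfl _ _).symm
    exact congrArg (fun q => tpair (extend F.φ Q) Y.action q (onSec F.f a))
      (extendMap_spair F.φ m t _ rfl p 1).symm

end Functors

section Fibered

variable {E : Type u} [Category.{w} E]

/-- A cartesian functor over `E`: it preserves cartesian morphisms. -/
def IsCartesianFunctor {X : BasedCategory.{v₁, u₁} E} {Y : BasedCategory.{v₂, u₂} E}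
    (F : BasedFunctor X Y) : Prop :=
  ∀ ⦃R S : E⦄ (f : R ⟶ S) ⦃a b : X.obj⦄ (φ : a ⟶ b), X.p.IsCartesian f φ →
    Y.p.IsCartesian f (F.map φ)

/-- The category of cartesian functors over `E`, with vertical natural transformations. -/
abbrev Cart (X : BasedCategory.{v₁, u₁} E) (Y : BasedCategory.{v₂, u₂} E) :=
  ObjectProperty.FullSubcategory (fun F : BasedFunctor X Y => IsCartesianFunctor F)

/-- `E/S` as a category over `E`. -/
abbrev overCat (S : E) : BasedCategory.{w, max u w} E where
  obj := Over S
  p := Over.forget S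

/-- A sieve `R` on `S`, viewed as a full subcategory of `E/S`, as a category over `E`. -/
abbrev sieveCat {S : E} (R : Sieve S) : BasedCategory.{w, max u w} E where
  obj := R.arrows.category
  p := R.arrows.diagram

/-- The inclusion of a sieve in `E/S`. -/
def sieveIncl {S : E} (R : Sieve S) : BasedFunctor (sieveCat R) (overCat S) where
  toFunctor := ObjectProperty.ι _
  w := rfl

theorem overCat_isCartesian {S : E} {R T : E} (f : R ⟶ T) {a b : Over S} (φ : a ⟶ b)
    (hφ : (Over.forget S).IsHomLift f φ) : (Over.forget S).IsCartesian f φ where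
  universal_property {a'} φ' hφ' := by
    have ea : a.left = R := IsHomLift.domain_eq (Over.forget S) f φ
    have eb : b.left = T := IsHomLift.codomain_eq (Over.forget S) f φ
    have ea' : a'.left = R := IsHomLift.domain_eq (Over.forget S) f φ'
    have h₁ : φ.left = eqToHom ea ≫ f ≫ eqToHom eb.symm := IsHomLift.fac' (Over.forget S) f φ
    have h₂ : φ'.left = eqToHom ea' ≫ f ≫ eqToHom eb.symm := IsHomLift.fac' (Over.forget S) f φ'
    have e : φ'.left = eqToHom (ea'.trans ea.symm) ≫ φ.left := by
      rw [h₁, h₂]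
      simp
    have e' : eqToHom (ea'.trans ea.symm) ≫ a.hom = a'.hom := by
      rw [← Over.w φ, ← Over.w φ', e, Category.assoc]
    refine ⟨Over.homMk (eqToHom (ea'.trans ea.symm)) e', ⟨?_, ?_⟩, ?_⟩
    · refine IsHomLift.of_fac' _ _ _ ea' ea ?_
      refine Eq.trans ?_ (congrArg (eqToHom ea' ≫ ·) (Category.id_comp (eqToHom ea.symm))).symm
      exact (eqToHom_trans ea' ea.symm).symm
    · ext
      exact e.symm
    · rintro χ ⟨hχ, -⟩
      ext
      have h₃ : χ.left = eqToHom ea' ≫ 𝟙 R ≫ eqToHom ea.symm :=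
        IsHomLift.fac' (Over.forget S) (𝟙 R) χ
      rw [h₃, Category.id_comp]
      exact eqToHom_trans ea' ea.symm

/-- The restriction functor from cartesian functors on `E/S` to cartesian functors on a sieve. -/
def restriction (X : BasedCategory.{v₁, u₁} E) {S : E} (R : Sieve S) :
    Cart (overCat S) X ⥤ Cart (sieveCat R) X :=
  ObjectProperty.lift _
    { obj := fun F => (sieveIncl R).comp F.obj
      map := fun α => BasedCategory.whiskerLeft (sieveIncl R) α.hom }
    (fun F A B f a b φ _ => F.property f _
      (overCat_isCartesian f ((sieveIncl R).map φ)
        (BasedFunctor.preserves_isHomLift (sieveIncl R) f φ)))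

/-- A stack on the site `(E, J)`. -/
structure IsStack (J : GrothendieckTopology E) (X : BasedCategory.{v₁, u₁} E) : Prop where
  isFibered : X.p.IsFibered
  descent (S : E) (R : Sieve S) (hR : R ∈ J S) : (restriction X R).IsEquivalence

/-- A category fibered in groupoids. -/
class IsFiberedInGroupoids (X : BasedCategory.{v₁, u₁} E) : Prop where
  isFibered : X.p.IsFibered
  isIso_of_vertical {x y : X.obj} (S : E) (m : x ⟶ y) (h : X.p.IsHomLift (𝟙 S) m) : IsIso m

attribute [instance] IsFiberedInGroupoids.isFibered

/-- Two objects of `X` over `S` are isomorphic in the fibre over `S`. -/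
def VerticallyIso (X : BasedCategory.{v₁, u₁} E) (S : E) (x y : X.obj) : Prop :=
  ∃ m : x ≅ y, X.p.IsHomLift (𝟙 S) m.hom

/-- A gerbe on the site `(E, J)`: a stack in groupoids which is locally nonempty, and such that
any two objects of a fibre are locally isomorphic. -/
structure IsGerbe (J : GrothendieckTopology E) (G : BasedCategory.{v₁, u₁} E) : Prop extends
    IsStack J G, IsFiberedInGroupoids G where
  locally_nonempty (S : E) : ∃ R ∈ J S, ∀ ⦃T : E⦄ (f : T ⟶ S), R f → ∃ x : G.obj, G.p.obj x = T
  locally_iso (S : E) (x y : G.obj) (hx : G.p.obj x = S) (hy : G.p.obj y = S) :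
    ∃ R ∈ J S, ∀ ⦃T : E⦄ (f : T ⟶ S), R f → VerticallyIso G T
      (Functor.IsPreFibered.pullbackObj hx f) (Functor.IsPreFibered.pullbackObj hy f)

/-- A functor over `E` is an equivalence over `E` if it has a cartesian quasi-inverse over `E`, with
vertical unit and counit. -/
def IsEEquivalence {X : BasedCategory.{v₁, u₁} E} {Y : BasedCategory.{v₂, u₂} E}
    (F : BasedFunctor X Y) : Prop :=
  ∃ K : BasedFunctor Y X, IsCartesianFunctor K ∧
    Nonempty (F.comp K ≅ BasedFunctor.id X) ∧ Nonempty (K.comp F ≅ BasedFunctor.id Y)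

end Fibered

section Automorphisms

open Functor.IsPreFibered

variable {E : Type u} [Category.{w} E] {G : BasedCategory.{v₁, u₁} E}

section

variable [IsFiberedInGroupoids G]

theorem isStronglyCartesian {x y : G.obj} {R S : E} (f : R ⟶ S) (m : x ⟶ y)
    (h : G.p.IsHomLift f m) : G.p.IsStronglyCartesian f m := by
  let π := pullbackMap (IsHomLift.codomain_eq G.p f m) f
  let χ := Functor.IsCartesian.map G.p f π m
  have : IsIso χ := IsFiberedInGroupoids.isIso_of_vertical R χ inferInstance
  have e : (asIso χ).hom ≫ π = m := Functor.IsCartesian.fac G.p f π m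
  have h₁ : G.p.IsHomLift (𝟙 R) (asIso χ).hom := inferInstanceAs (G.p.IsHomLift (𝟙 R) χ)
  have h₂ : G.p.IsCartesian f ((asIso χ).hom ≫ π) := inferInstance
  rw [e] at h₂
  infer_instance

/-- In a category fibered in groupoids, morphisms with the same target are compared by morphisms of
the base. -/
theorem exists_over {a b x : G.obj} {R R' S : E} {f : R ⟶ S} {f' : R' ⟶ S} (α : a ⟶ x) (β : b ⟶ x)
    (hα : G.p.IsHomLift f α) (hβ : G.p.IsHomLift f' β) (g : R' ⟶ R) (h : g ≫ f = f') :
    ∃! χ : b ⟶ a, G.p.IsHomLift g χ ∧ χ ≫ α = β :=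
  have := isStronglyCartesian f α hα
  Functor.IsStronglyCartesian.universal_property G.p f α g f' h.symm β

/-- The comparison morphism over `g`. -/
noncomputable def compare {a b x : G.obj} {R R' S : E} {f : R ⟶ S} {f' : R' ⟶ S} (α : a ⟶ x)
    (β : b ⟶ x) (hα : G.p.IsHomLift f α) (hβ : G.p.IsHomLift f' β) (g : R' ⟶ R)
    (h : g ≫ f = f') : b ⟶ a :=
  (exists_over α β hα hβ g h).choose

section

variable {a b x : G.obj} {R R' S : E} {f : R ⟶ S} {f' : R' ⟶ S} (α : a ⟶ x)
    (β : b ⟶ x) (hα : G.p.IsHomLift f α) (hβ : G.p.IsHomLift f' β) (g : R' ⟶ R) (h : g ≫ f = f')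

theorem compare_lift : G.p.IsHomLift g (compare α β hα hβ g h) :=
  (exists_over α β hα hβ g h).choose_spec.1.1

theorem compare_fac : compare α β hα hβ g h ≫ α = β :=
  (exists_over α β hα hβ g h).choose_spec.1.2

end

theorem compare_unique {a b x : G.obj} {R R' S : E} {f : R ⟶ S} (α : a ⟶ x)
    (hα : G.p.IsHomLift f α) (g : R' ⟶ R) (χ χ' : b ⟶ a)
    (hχ : G.p.IsHomLift g χ) (hχ' : G.p.IsHomLift g χ') (e : χ ≫ α = χ' ≫ α) : χ = χ' :=
  (exists_over α (χ' ≫ α) hα (inferInstance : G.p.IsHomLift (g ≫ f) (χ' ≫ α)) g rfl).unique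
    ⟨hχ, e⟩ ⟨hχ', rfl⟩

/-- The group of automorphisms of `z` in its fibre. The product is the composition
`θ * θ' = θ ∘ θ'`. -/
def VAut (z : G.obj) : Subgroup (Aut z) where
  carrier := {θ | G.p.map θ.hom = 𝟙 _}
  one_mem' := G.p.map_id _
  mul_mem' {θ θ'} h h' := by
    change G.p.map (θ'.hom ≫ θ.hom) = _
    rw [G.p.map_comp, h, h', Category.comp_id]
  inv_mem' {θ} h := by
    change G.p.map θ.inv = _
    have e := congrArg G.p.map θ.hom_inv_id
    rw [G.p.map_comp, h, Category.id_comp, G.p.map_id] at e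
    exact e

theorem VAut.lift {z : G.obj} (θ : VAut z) {R : E} (hz : G.p.obj z = R) :
    G.p.IsHomLift (𝟙 R) θ.1.hom := by
  subst hz
  have h : G.p.map θ.1.hom = 𝟙 _ := θ.2
  rw [← h]
  infer_instance

/-- A vertical endomorphism is a vertical automorphism. -/
noncomputable def VAut.mk' {z : G.obj} {R : E} (m : z ⟶ z) (h : G.p.IsHomLift (𝟙 R) m) : VAut z :=
  have : IsIso m := IsFiberedInGroupoids.isIso_of_vertical R m h
  ⟨asIso m, by
    obtain rfl := IsHomLift.domain_eq G.p (𝟙 R) m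
    exact (IsHomLift.eq_of_isHomLift G.p (𝟙 _) m).symm⟩

theorem VAut.ext' {z : G.obj} {θ θ' : VAut z} (h : θ.1.hom = θ'.1.hom) : θ = θ' :=
  Subtype.ext (Iso.ext h)

theorem exists_pull {z' z : G.obj} (c : z' ⟶ z) (θ : VAut z) :
    ∃! χ : VAut z', χ.1.hom ≫ c = c ≫ θ.1.hom := by
  have h₁ : G.p.IsHomLift (G.p.map c) c := inferInstance
  have h₂ : G.p.IsHomLift (G.p.map c) (c ≫ θ.1.hom) := by
    have := VAut.lift θ rfl
    infer_instance
  obtain ⟨χ, ⟨h, e⟩, hu⟩ := exists_over c (c ≫ θ.1.hom) h₁ h₂ (𝟙 _) (Category.id_comp _)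
  exact ⟨VAut.mk' χ h, e, fun χ' e' => VAut.ext' (hu _ ⟨VAut.lift χ' rfl, e'⟩)⟩

/-- The restriction of vertical automorphisms along a morphism `c : z' ⟶ z`. -/
noncomputable def VAut.pull {z' z : G.obj} (c : z' ⟶ z) : VAut z →* VAut z' :=
  MonoidHom.mk' (fun θ => (exists_pull c θ).choose) (by
    intro θ θ'
    refine ((exists_pull c (θ * θ')).choose_spec.2 _ ?_).symm
    have h : (exists_pull c θ).choose.1.hom ≫ c = c ≫ θ.1.hom := (exists_pull c θ).choose_spec.1
    have h' : (exists_pull c θ').choose.1.hom ≫ c = c ≫ θ'.1.hom :=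
      (exists_pull c θ').choose_spec.1
    change ((exists_pull c θ').choose.1.hom ≫ (exists_pull c θ).choose.1.hom) ≫ c =
      c ≫ θ'.1.hom ≫ θ.1.hom
    rw [Category.assoc, h, ← Category.assoc, h', Category.assoc])

theorem VAut.pull_fac {z' z : G.obj} (c : z' ⟶ z) (θ : VAut z) :
    (VAut.pull c θ).1.hom ≫ c = c ≫ θ.1.hom :=
  (exists_pull c θ).choose_spec.1

theorem VAut.pull_eq {z' z : G.obj} (c : z' ⟶ z) (θ : VAut z) (χ : VAut z')
    (h : χ.1.hom ≫ c = c ≫ θ.1.hom) : VAut.pull c θ = χ :=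
  ((exists_pull c θ).choose_spec.2 χ h).symm

theorem VAut.pull_comp {z'' z' z : G.obj} (d : z'' ⟶ z') (c : z' ⟶ z) (θ : VAut z) :
    VAut.pull (d ≫ c) θ = VAut.pull d (VAut.pull c θ) :=
  VAut.pull_eq _ _ _ (by
    rw [← Category.assoc, VAut.pull_fac, Category.assoc, VAut.pull_fac, Category.assoc])

theorem VAut.pull_id {z : G.obj} (θ : VAut z) : VAut.pull (𝟙 z) θ = θ :=
  VAut.pull_eq _ _ _ (by rw [Category.comp_id, Category.id_comp])

variable {y : G.obj} {U : E} (hy : G.p.obj y = U)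

/-- The transition morphisms between the restrictions of `y`. -/
noncomputable def pbMap {V W : E} (u : W ⟶ V) {t : V ⟶ U} {t' : W ⟶ U} (h : u ≫ t = t') :
    pullbackObj hy t' ⟶ pullbackObj hy t :=
  compare (pullbackMap hy t) (pullbackMap hy t') inferInstance inferInstance u h

theorem pbMap_lift {V W : E} (u : W ⟶ V) {t : V ⟶ U} {t' : W ⟶ U} (h : u ≫ t = t') :
    G.p.IsHomLift u (pbMap hy u h) := compare_lift _ _ _ _ _ _

theorem pbMap_fac {V W : E} (u : W ⟶ V) {t : V ⟶ U} {t' : W ⟶ U} (h : u ≫ t = t') :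
    pbMap hy u h ≫ pullbackMap hy t = pullbackMap hy t' := compare_fac _ _ _ _ _ _

theorem pbMap_id {V : E} {t : V ⟶ U} (h : 𝟙 V ≫ t = t) :
    pbMap hy (𝟙 V) h = 𝟙 (pullbackObj hy t) := by
  refine compare_unique (f := t) (pullbackMap hy t) inferInstance (𝟙 V) _ _
    (pbMap_lift _ _ _) (IsHomLift.id (pullbackObj_proj hy t)) ?_
  rw [pbMap_fac, Category.id_comp]

theorem pbMap_comp {V W Z : E} (v : Z ⟶ W) (u : W ⟶ V) {t : V ⟶ U} {t' : W ⟶ U} {t'' : Z ⟶ U}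
    (h : u ≫ t = t') (h' : v ≫ t' = t'') (h'' : (v ≫ u) ≫ t = t'') :
    pbMap hy (v ≫ u) h'' = pbMap hy v h' ≫ pbMap hy u h := by
  have := pbMap_lift hy v h'
  have := pbMap_lift hy u h
  refine compare_unique (f := t) (pullbackMap hy t) inferInstance (v ≫ u) _ _
    (pbMap_lift _ _ _) inferInstance ?_
  rw [pbMap_fac, Category.assoc, pbMap_fac, pbMap_fac]

/-- The functor `E/U ⥤ G`, `t ↦ t^* y`. -/
noncomputable def pullFunctor : BasedFunctor (overCat U) G where
  obj T := pullbackObj hy T.hom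
  map u := pbMap hy u.left (Over.w u)
  map_id T := pbMap_id hy _
  map_comp v u := pbMap_comp hy _ _ _ _ _
  w := CategoryTheory.Functor.ext (fun T => pullbackObj_proj hy T.hom) (fun T T' u => by
    have := pbMap_lift hy u.left (Over.w u)
    exact IsHomLift.fac' G.p u.left (pbMap hy u.left (Over.w u)))

theorem isCartesianFunctor_of_groupoids {X : BasedCategory.{v₂, u₂} E} (F : BasedFunctor X G) :
    IsCartesianFunctor F := fun R S f a b φ _ => by
  have := isStronglyCartesian f (F.map φ) (BasedFunctor.preserves_isHomLift F f φ)
  infer_instance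

/-- A compatible family of vertical automorphisms is a vertical natural endomorphism. -/
def transOf {X : BasedCategory.{v₂, u₂} E} (F : BasedFunctor X G) (Θ : ∀ x, VAut (F.obj x))
    (hΘ : ∀ {x y} (u : x ⟶ y), VAut.pull (F.map u) (Θ y) = Θ x) : BasedNatTrans F F where
  app x := (Θ x).1.hom
  naturality x y u := by
    rw [← hΘ u]
    exact (VAut.pull_fac (F.map u) (Θ y)).symm
  isHomLift' x := VAut.lift (Θ x) (F.w_obj x)

theorem pull_of_trans {X : BasedCategory.{v₂, u₂} E} {F : BasedFunctor X G}
    (η : BasedNatTrans F F) {x y : X.obj} (u : x ⟶ y) :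
    VAut.pull (F.map u) (VAut.mk' (η.app y) (η.isHomLift' y)) =
      VAut.mk' (η.app x) (η.isHomLift' x) :=
  VAut.pull_eq _ _ _ (η.naturality u).symm

/-- Vertical automorphisms descend. -/
theorem vaut_descent {J : GrothendieckTopology E} (hG : IsStack J G) {R : Sieve U} (hR : R ∈ J U)
    (Θ : ∀ {V : E} (f : V ⟶ U), R f → VAut (pullbackObj hy f))
    (hΘ : ∀ {V W : E} (u : W ⟶ V) {f : V ⟶ U} {f' : W ⟶ U} (h : u ≫ f = f') (hf : R f)
      (hf' : R f'), VAut.pull (pbMap hy u h) (Θ f hf) = Θ f' hf') :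
    ∃! θ : VAut y, ∀ {V : E} (f : V ⟶ U) (hf : R f),
      VAut.pull (pullbackMap hy f) θ = Θ f hf := by
  have := hG.descent U R hR
  let F : Cart (overCat U) G := ⟨pullFunctor hy, isCartesianFunctor_of_groupoids _⟩
  have hc : IsIso (pullbackMap hy (𝟙 U)) :=
    IsFiberedInGroupoids.isIso_of_vertical U _ inferInstance
  have hfac {V : E} (f : V ⟶ U) (θ : VAut y) : VAut.pull (pullbackMap hy f) θ =
      VAut.pull (pbMap hy f (Category.comp_id f)) (VAut.pull (pullbackMap hy (𝟙 U)) θ) := by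
    rw [← VAut.pull_comp, pbMap_fac]
  have hinj {θ θ' : VAut y} (h : VAut.pull (pullbackMap hy (𝟙 U)) θ =
      VAut.pull (pullbackMap hy (𝟙 U)) θ') : θ = θ' := by
    rw [← VAut.pull_id θ, ← VAut.pull_id θ', ← IsIso.inv_hom_id (pullbackMap hy (𝟙 U)),
      VAut.pull_comp, VAut.pull_comp, h]
  refine existsUnique_of_exists_of_unique ?_ ?_
  · let τ : (restriction G R).obj F ⟶ (restriction G R).obj F :=
      ObjectProperty.homMk (transOf ((restriction G R).obj F).obj
        (fun f => Θ f.obj.hom f.property) (fun u => hΘ _ (Over.w u.hom) _ _))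
    let η : BasedNatTrans (pullFunctor hy) (pullFunctor hy) := ((restriction G R).preimage τ).hom
    have hη : ∀ {V : E} (f : V ⟶ U) (hf : R f), η.app (Over.mk f) = (Θ f hf).1.hom := by
      intro V f hf
      have e := congrArg (fun k : (restriction G R).obj F ⟶ (restriction G R).obj F =>
        k.hom.app (⟨Over.mk f, hf⟩ : R.arrows.category)) ((restriction G R).map_preimage τ)
      exact e
    let η₁ : VAut (pullbackObj hy (𝟙 U)) :=
      VAut.mk' (η.app (Over.mk (𝟙 U))) (η.isHomLift' (Over.mk (𝟙 U)))
    refine ⟨VAut.pull (inv (pullbackMap hy (𝟙 U))) η₁, fun {V} f hf => ?_⟩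
    rw [hfac, ← VAut.pull_comp (pullbackMap hy (𝟙 U)), IsIso.hom_inv_id, VAut.pull_id]
    refine (pull_of_trans η (Over.homMk f (Category.comp_id f) : Over.mk f ⟶ Over.mk (𝟙 U))).trans ?_
    exact VAut.ext' (hη f hf)
  · intro θ θ' h h'
    let T (θ : VAut y) : F ⟶ F := ObjectProperty.homMk (transOf (pullFunctor hy)
      (fun f => VAut.pull (pullbackMap hy f.hom) θ) (fun {T T'} u =>
        (VAut.pull_comp (pbMap hy u.left (Over.w u)) (pullbackMap hy T'.hom) θ).symm.trans
          (congrArg (fun c => VAut.pull c θ) (pbMap_fac hy _ _))))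
    have e : T θ = T θ' := by
      refine (restriction G R).map_injective ?_
      refine ObjectProperty.hom_ext _ (BasedNatTrans.ext _ _ (NatTrans.ext (funext fun f => ?_)))
      exact congrArg (fun k : VAut _ => k.1.hom) ((h f.obj.hom f.property).trans
        (h' f.obj.hom f.property).symm)
    have e' := congrArg (fun k : F ⟶ F => k.hom.app (Over.mk (𝟙 U))) e
    exact hinj (VAut.ext' e')

end

end Automorphisms

section AutSheaf

open Functor.IsPreFibered

variable {E : Type u} [Category.{w} E] {G : BasedCategory.{v₁, u₁} E}

theorem over_ind {S : E} {T : Over S} (motive : ∀ {V : Over S}, (V ⟶ T) → Prop)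
    (h : ∀ {V : E} (f : V ⟶ T.left), motive (Over.homMk f : Over.mk (f ≫ T.hom) ⟶ T))
    {V : Over S} (g : V ⟶ T) : motive g := by
  have key : ∀ (v : V.left ⟶ S) (e : g.left ≫ T.hom = v),
      motive (Over.homMk g.left e : Over.mk v ⟶ T) := by
    rintro v rfl
    exact h g.left
  exact key V.hom (Over.w g)

section

variable [IsFiberedInGroupoids G]

theorem VAut.pull_injective {z' z : G.obj} (c : z' ⟶ z) [IsIso c] :
    Function.Injective (VAut.pull c) := fun θ θ' h => by
  rw [← VAut.pull_id θ, ← VAut.pull_id θ', ← IsIso.inv_hom_id c, VAut.pull_comp, VAut.pull_comp, h]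

/-- The morphism of `G` over an identity of the base that compares the restrictions of `x` and `y`
along `m : x ⟶ y`. -/
noncomputable def autCmp {x y : G.obj} (m : x ⟶ y) {U : E} (t : U ⟶ G.p.obj x)
    (s : U ⟶ G.p.obj y) (h : t ≫ G.p.map m = s) :
    pullbackObj (p := G.p) (a := y) rfl s ⟶ pullbackObj (p := G.p) (a := x) rfl t :=
  compare (pullbackMap (p := G.p) (a := x) rfl t ≫ m) (pullbackMap (p := G.p) (a := y) rfl s)
    (inferInstance : G.p.IsHomLift (t ≫ G.p.map m) _) inferInstance (𝟙 U)
    ((Category.id_comp _).trans h)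

theorem autCmp_lift {x y : G.obj} (m : x ⟶ y) {U : E} (t : U ⟶ G.p.obj x)
    (s : U ⟶ G.p.obj y) (h : t ≫ G.p.map m = s) : G.p.IsHomLift (𝟙 U) (autCmp m t s h) :=
  compare_lift _ _ _ _ _ _

theorem autCmp_fac {x y : G.obj} (m : x ⟶ y) {U : E} (t : U ⟶ G.p.obj x)
    (s : U ⟶ G.p.obj y) (h : t ≫ G.p.map m = s) :
    autCmp m t s h ≫ pullbackMap (p := G.p) (a := x) rfl t ≫ m =
      pullbackMap (p := G.p) (a := y) rfl s :=
  compare_fac _ _ _ _ _ _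

theorem base_lift {x y : G.obj} (m : x ⟶ y) {U : E} (t : U ⟶ G.p.obj x) :
    G.p.IsHomLift (t ≫ G.p.map m) (pullbackMap (p := G.p) (a := x) rfl t ≫ m) :=
  inferInstance

theorem autCmp_res {x y : G.obj} (m : x ⟶ y) {U V : E} (u : V ⟶ U) {t : U ⟶ G.p.obj x}
    {s : U ⟶ G.p.obj y} (h : t ≫ G.p.map m = s) {t' : V ⟶ G.p.obj x} {s' : V ⟶ G.p.obj y}
    (h' : t' ≫ G.p.map m = s') (ht : u ≫ t = t') (hs : u ≫ s = s') :
    autCmp m t' s' h' ≫ pbMap (y := x) rfl u ht = pbMap (y := y) rfl u hs ≫ autCmp m t s h := by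
  have h₁ := autCmp_lift m t s h
  have h₂ := autCmp_lift m t' s' h'
  have h₃ := pbMap_lift (y := x) rfl u ht
  have h₄ := pbMap_lift (y := y) rfl u hs
  refine compare_unique (pullbackMap (p := G.p) (a := x) rfl t ≫ m) (base_lift m t) u
    _ _ inferInstance inferInstance ?_
  rw [Category.assoc, Category.assoc, autCmp_fac, pbMap_fac, ← autCmp_fac m t' s' h',
    ← Category.assoc (pbMap (y := x) rfl u ht), pbMap_fac]

theorem autCmp_id {x : G.obj} {U : E} (t : U ⟶ G.p.obj x) (h : t ≫ G.p.map (𝟙 x) = t) :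
    autCmp (𝟙 x) t t h = 𝟙 _ := by
  refine compare_unique (f := t) (pullbackMap (p := G.p) (a := x) rfl t) inferInstance (𝟙 U)
    _ _ (autCmp_lift _ _ _ _) (IsHomLift.id (pullbackObj_proj _ _)) ?_
  rw [Category.id_comp]
  refine Eq.trans ?_ (autCmp_fac (𝟙 x) t t h)
  rw [Category.comp_id]

theorem autCmp_comp {x y z : G.obj} (m : x ⟶ y) (n : y ⟶ z) {U : E} (t : U ⟶ G.p.obj x)
    (s : U ⟶ G.p.obj y) (r : U ⟶ G.p.obj z) (h : t ≫ G.p.map m = s) (h' : s ≫ G.p.map n = r)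
    (h'' : t ≫ G.p.map (m ≫ n) = r) :
    autCmp (m ≫ n) t r h'' = autCmp n s r h' ≫ autCmp m t s h := by
  have h₁ := autCmp_lift m t s h
  have h₂ := autCmp_lift n s r h'
  refine compare_unique (pullbackMap (p := G.p) (a := x) rfl t ≫ m ≫ n) (base_lift (m ≫ n) t) (𝟙 U)
    _ _ (autCmp_lift _ _ _ _) inferInstance ?_
  rw [autCmp_fac, ← autCmp_fac n s r h', ← autCmp_fac m t s h]
  simp only [Category.assoc]

variable [LocallySmall.{w} G.obj]

instance (z : G.obj) : Small.{w} (VAut z) :=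
  small_of_injective (f := fun θ : VAut z => θ.1.hom) fun _ _ h => VAut.ext' h

/-- The group of vertical automorphisms of `z`, in the universe of the sheaves. -/
abbrev SAut (z : G.obj) := Shrink.{w} (VAut z)

/-- The identification with the group of vertical automorphisms. -/
noncomputable abbrev SAut.equiv (z : G.obj) : SAut.{w} z ≃* VAut z := Shrink.mulEquiv

/-- The restriction of vertical automorphisms along a morphism `c : z' ⟶ z`. -/
noncomputable def SAut.pull {z' z : G.obj} (c : z' ⟶ z) : SAut.{w} z →* SAut.{w} z' :=
  (SAut.equiv z').symm.toMonoidHom.comp ((VAut.pull c).comp (SAut.equiv z).toMonoidHom)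

theorem SAut.equiv_pull {z' z : G.obj} (c : z' ⟶ z) (θ : SAut.{w} z) :
    SAut.equiv z' (SAut.pull c θ) = VAut.pull c (SAut.equiv z θ) :=
  (SAut.equiv z').apply_symm_apply _

theorem SAut.pull_comp {z'' z' z : G.obj} (d : z'' ⟶ z') (c : z' ⟶ z) (θ : SAut.{w} z) :
    SAut.pull (d ≫ c) θ = SAut.pull d (SAut.pull c θ) :=
  (SAut.equiv z'').injective (by
    rw [SAut.equiv_pull, SAut.equiv_pull, SAut.equiv_pull, VAut.pull_comp])

theorem SAut.pull_id {z : G.obj} (θ : SAut.{w} z) : SAut.pull (𝟙 z) θ = θ :=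
  (SAut.equiv z).injective (by rw [SAut.equiv_pull, VAut.pull_id])

/-- The presheaf of vertical automorphisms of an object `x` on `E/S`, where `x` is over `S`. -/
noncomputable def autPre (x : G.obj) : (Over (G.p.obj x))ᵒᵖ ⥤ GrpCat.{w} where
  obj T := GrpCat.of (SAut.{w} (pullbackObj (p := G.p) (a := x) rfl T.unop.hom))
  map u := GrpCat.ofHom (SAut.pull (pbMap (y := x) rfl u.unop.left (Over.w u.unop)))
  map_id T := by
    refine GrpCat.hom_ext (MonoidHom.ext fun θ => ?_)
    refine Eq.trans ?_ (SAut.pull_id θ)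
    exact congrArg (fun c => SAut.pull c θ) (pbMap_id _ _)
  map_comp {T T' T''} u v := by
    refine GrpCat.hom_ext (MonoidHom.ext fun θ => ?_)
    refine Eq.trans ?_ (SAut.pull_comp _ _ θ)
    exact congrArg (fun c => SAut.pull c θ)
      (pbMap_comp rfl v.unop.left u.unop.left (Over.w u.unop) (Over.w v.unop) _)

theorem autPre_isSheaf {J : GrothendieckTopology E} (hG : IsStack J G) (x : G.obj) :
    Presheaf.IsSheaf (J.over (G.p.obj x)) (autPre x) := by
  refine isSheaf_of_forget _ ((isSheaf_iff_isSheaf_of_type _ _).2 fun T R hR Fam hFam => ?_)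
  let fam {V : E} (f : V ⟶ T.left) (hf : R (Over.homMk f : Over.mk (f ≫ T.hom) ⟶ T)) :
    VAut (pullbackObj (p := G.p) (a := x) rfl (f ≫ T.hom)) :=
    SAut.equiv _ (Fam _ hf)
  let y : G.obj := pullbackObj (p := G.p) (a := x) rfl T.hom
  have hy : G.p.obj y = T.left := pullbackObj_proj _ _
  have hyx : G.p.IsHomLift T.hom (pullbackMap (p := G.p) (a := x) rfl T.hom) := inferInstance
  let k {V : E} (f : V ⟶ T.left) : pullbackObj hy f ⟶
      pullbackObj (p := G.p) (a := x) rfl (f ≫ T.hom) :=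
    compare (pullbackMap (p := G.p) (a := x) rfl (f ≫ T.hom))
      (pullbackMap hy f ≫ pullbackMap (p := G.p) (a := x) rfl T.hom)
      inferInstance (inferInstance : G.p.IsHomLift (f ≫ T.hom) _) (𝟙 V) (Category.id_comp _)
  have k_lift {V : E} (f : V ⟶ T.left) : G.p.IsHomLift (𝟙 V) (k f) := compare_lift _ _ _ _ _ _
  have k_fac {V : E} (f : V ⟶ T.left) : k f ≫ pullbackMap (p := G.p) (a := x) rfl (f ≫ T.hom) =
    pullbackMap hy f ≫ pullbackMap (p := G.p) (a := x) rfl T.hom := compare_fac _ _ _ _ _ _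
  have k_iso {V : E} (f : V ⟶ T.left) : IsIso (k f) :=
    IsFiberedInGroupoids.isIso_of_vertical V _ (k_lift f)
  have k_map {V W : E} (u : W ⟶ V) {f : V ⟶ T.left} {f' : W ⟶ T.left} (h : u ≫ f = f')
      (h' : u ≫ f ≫ T.hom = f' ≫ T.hom) :
      pbMap hy u h ≫ k f = k f' ≫ pbMap (y := x) rfl u h' := by
    have := pbMap_lift hy u h
    have := pbMap_lift (y := x) rfl u h'
    refine compare_unique (f := f ≫ T.hom) (pullbackMap (p := G.p) (a := x) rfl (f ≫ T.hom))
      inferInstance u _ _ inferInstance inferInstance ?_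
    rw [Category.assoc, Category.assoc, k_fac, pbMap_fac, k_fac, ← Category.assoc, pbMap_fac]
  have k_pb {V : E} (f : V ⟶ T.left) :
      k f ≫ pbMap (y := x) rfl f (rfl : f ≫ T.hom = f ≫ T.hom) = pullbackMap hy f := by
    have := pbMap_lift (y := x) rfl f (rfl : f ≫ T.hom = f ≫ T.hom)
    refine compare_unique (f := T.hom) (pullbackMap (p := G.p) (a := x) rfl T.hom)
      inferInstance f _ _ inferInstance inferInstance ?_
    rw [Category.assoc, pbMap_fac, k_fac]
  have fam_compat {V W : E} (u : W ⟶ V) {f : V ⟶ T.left} {f' : W ⟶ T.left} (h : u ≫ f = f')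
      (h' : u ≫ f ≫ T.hom = f' ≫ T.hom) (hf : R (Over.homMk f : Over.mk (f ≫ T.hom) ⟶ T))
      (hf' : R (Over.homMk f' : Over.mk (f' ≫ T.hom) ⟶ T)) :
      VAut.pull (pbMap (y := x) rfl u h') (fam f hf) = fam f' hf' := by
    have e := hFam (Over.homMk u h' : Over.mk (f' ≫ T.hom) ⟶ Over.mk (f ≫ T.hom))
      (𝟙 (Over.mk (f' ≫ T.hom))) hf hf' (by ext; simpa using h)
    refine (SAut.equiv_pull _ _).symm.trans (congrArg (SAut.equiv _) (e.trans ?_))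
    exact ConcreteCategory.congr_hom ((autPre x).map_id (op (Over.mk (f' ≫ T.hom)))) (Fam _ hf')
  have hmem {V : E} (f : V ⟶ T.left) : Sieve.overEquiv T R f ↔
    R (Over.homMk f : Over.mk (f ≫ T.hom) ⟶ T) := Sieve.overEquiv_iff _ _
  obtain ⟨θ, hθ, hu⟩ := vaut_descent hy hG (R := Sieve.overEquiv T R)
    ((GrothendieckTopology.mem_over_iff _ _).1 hR)
    (fun f hf => VAut.pull (k f) (fam f ((hmem f).1 hf)))
    (by
      intro V W u f f' h hf hf'
      have h' : u ≫ f ≫ T.hom = f' ≫ T.hom := by rw [← h, Category.assoc]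
      rw [← VAut.pull_comp, k_map u h h', VAut.pull_comp, fam_compat u h h'])
  have hiff (χ : VAut y) {V : E} (f : V ⟶ T.left)
      (hf : R (Over.homMk f : Over.mk (f ≫ T.hom) ⟶ T)) :
      VAut.pull (pullbackMap hy f) χ = VAut.pull (k f) (fam f hf) ↔
        VAut.pull (pbMap (y := x) rfl f (rfl : f ≫ T.hom = f ≫ T.hom)) χ = fam f hf := by
    rw [← k_pb f, VAut.pull_comp]
    exact (VAut.pull_injective (k f)).eq_iff
  have hSV (χ : SAut.{w} y) {V : E} (f : V ⟶ T.left)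
      (hf : R (Over.homMk f : Over.mk (f ≫ T.hom) ⟶ T)) :
      SAut.pull (pbMap (y := x) rfl f (rfl : f ≫ T.hom = f ≫ T.hom)) χ = Fam _ hf ↔
        VAut.pull (pbMap (y := x) rfl f (rfl : f ≫ T.hom = f ≫ T.hom)) (SAut.equiv y χ) =
          fam f hf := by
    rw [← SAut.equiv_pull]
    exact (SAut.equiv _).injective.eq_iff.symm
  refine ⟨(SAut.equiv y).symm θ, ?_, fun χ hχ => (SAut.equiv y).injective ?_⟩
  · intro V g
    refine over_ind (fun {V} g => ∀ hg : R g,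
      (autPre x ⋙ forget GrpCat.{w}).map g.op ((SAut.equiv y).symm θ) = Fam g hg)
      (fun f hf => ?_) g
    refine (hSV _ f hf).2 ?_
    rw [MulEquiv.apply_symm_apply]
    exact (hiff θ f hf).1 (hθ f ((hmem f).2 hf))
  · rw [MulEquiv.apply_symm_apply]
    exact hu _ fun f hf => (hiff _ f ((hmem f).1 hf)).2
      ((hSV χ f ((hmem f).1 hf)).1 (hχ _ ((hmem f).1 hf)))

variable {J : GrothendieckTopology E} (hG : IsStack J G)

/-- The sheaf of groups `Aut_S(x)` on `E/S`, where `x` is over `S`. -/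
noncomputable def autSheaf (x : G.obj) : FAGRSC J where
  base := G.p.obj x
  sheaf := ⟨autPre x, autPre_isSheaf hG x⟩

/-- The map `Aut(x) ⟶ Aut(y)`, `θ ↦ m θ m⁻¹`, induced by a morphism `m : x ⟶ y`. -/
noncomputable def autHom {x y : G.obj} (m : x ⟶ y) : autSheaf hG x ⟶ autSheaf hG y where
  base := G.p.map m
  app t s h := GrpCat.ofHom (SAut.pull (autCmp m t s h))
  naturality {U V} u {t s} h {t' s'} h' ht hs := by
    refine GrpCat.hom_ext (MonoidHom.ext fun θ => ?_)
    refine (SAut.pull_comp _ _ θ).symm.trans (Eq.trans ?_ (SAut.pull_comp _ _ θ))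
    refine congrArg (fun c => SAut.pull c θ) ?_
    exact autCmp_res m u h h' ht hs

/-- The functor `x ↦ Aut(x)` from a stack in groupoids to sheaves of groups. -/
noncomputable def autFunctor : G.obj ⥤ FAGRSC J where
  obj x := autSheaf hG x
  map m := autHom hG m
  map_id x := by
    refine SliceSheaf.hom_ext (G.p.map_id x) fun {U} t s h h' => ?_
    obtain rfl : t = s := (Category.comp_id t).symm.trans h'
    refine Eq.trans ?_ (SliceSheaf.id_app (autSheaf hG x) t h').symm
    refine GrpCat.hom_ext (MonoidHom.ext fun θ => ?_)
    exact (congrArg (fun c => SAut.pull c θ) (autCmp_id t h)).trans (SAut.pull_id θ)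
  map_comp {x y z} m n := by
    refine SliceSheaf.hom_ext (G.p.map_comp m n) fun {U} t s h h' => ?_
    have e : (t ≫ G.p.map m) ≫ G.p.map n = s := (Category.assoc _ _ _).trans h'
    refine Eq.trans ?_ (SliceSheaf.comp_app (autHom hG m) (autHom hG n) t (t ≫ G.p.map m) s
      rfl e h').symm
    refine GrpCat.hom_ext (MonoidHom.ext fun θ => ?_)
    exact (congrArg (fun c => SAut.pull c θ) (autCmp_comp m n t _ s rfl e h)).trans
      (SAut.pull_comp (autCmp n _ s e) (autCmp m t _ rfl) θ)

end

section

variable {G' : BasedCategory.{v₂, u₂} E} [IsFiberedInGroupoids G] [IsFiberedInGroupoids G']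
  (F : BasedFunctor G G')

theorem map_vertical {z : G.obj} (θ : VAut z) : G'.p.map (F.map θ.1.hom) = 𝟙 _ := by
  have h := VAut.lift θ rfl
  have := BasedFunctor.preserves_isHomLift F (𝟙 (G.p.obj z)) θ.1.hom
  have e := IsHomLift.fac' G'.p (𝟙 (G.p.obj z)) (F.map θ.1.hom)
  rw [e]
  simp

/-- The action of a functor over `E` on vertical automorphisms. -/
def VAut.map (z : G.obj) : VAut z →* VAut (F.obj z) :=
  MonoidHom.mk' (fun θ => ⟨F.mapIso θ.1, map_vertical F θ⟩) (by
    intro θ θ'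
    exact VAut.ext' (F.map_comp θ'.1.hom θ.1.hom))

theorem VAut.map_pull {z' z : G.obj} (c : z' ⟶ z) (θ : VAut z) :
    VAut.map F z' (VAut.pull c θ) = VAut.pull (F.map c) (VAut.map F z θ) := by
  refine (VAut.pull_eq _ _ _ ?_).symm
  change F.map (VAut.pull c θ).1.hom ≫ F.map c = F.map c ≫ F.map θ.1.hom
  rw [← F.map_comp, VAut.pull_fac, F.map_comp]

theorem base_eq_lift {x : G.obj} {U : E} (t : U ⟶ G.p.obj x) (s : U ⟶ G'.p.obj (F.obj x))
    (h : t ≫ eqToHom (F.w_obj x).symm = s) :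
    G'.p.IsHomLift s (F.map (pullbackMap (p := G.p) (a := x) rfl t)) := by
  have := BasedFunctor.preserves_isHomLift F t (pullbackMap (p := G.p) (a := x) rfl t)
  rw [← h]
  infer_instance

/-- The comparison of the restriction of `F x` with the image of the restriction of `x`. -/
noncomputable def mapCmp (x : G.obj) {U : E} (t : U ⟶ G.p.obj x) (s : U ⟶ G'.p.obj (F.obj x))
    (h : t ≫ eqToHom (F.w_obj x).symm = s) :
    pullbackObj (p := G'.p) (a := F.obj x) rfl s ⟶
      F.obj (pullbackObj (p := G.p) (a := x) rfl t) :=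
  compare (F.map (pullbackMap (p := G.p) (a := x) rfl t))
    (pullbackMap (p := G'.p) (a := F.obj x) rfl s) (base_eq_lift F t s h) inferInstance (𝟙 U)
    (Category.id_comp s)

theorem mapCmp_lift (x : G.obj) {U : E} (t : U ⟶ G.p.obj x) (s : U ⟶ G'.p.obj (F.obj x))
    (h : t ≫ eqToHom (F.w_obj x).symm = s) : G'.p.IsHomLift (𝟙 U) (mapCmp F x t s h) :=
  compare_lift _ _ _ _ _ _

theorem mapCmp_fac (x : G.obj) {U : E} (t : U ⟶ G.p.obj x) (s : U ⟶ G'.p.obj (F.obj x))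
    (h : t ≫ eqToHom (F.w_obj x).symm = s) :
    mapCmp F x t s h ≫ F.map (pullbackMap (p := G.p) (a := x) rfl t) =
      pullbackMap (p := G'.p) (a := F.obj x) rfl s := compare_fac _ _ _ _ _ _

theorem mapCmp_res (x : G.obj) {U V : E} (u : V ⟶ U) {t : U ⟶ G.p.obj x}
    {s : U ⟶ G'.p.obj (F.obj x)} (h : t ≫ eqToHom (F.w_obj x).symm = s) {t' : V ⟶ G.p.obj x}
    {s' : V ⟶ G'.p.obj (F.obj x)} (h' : t' ≫ eqToHom (F.w_obj x).symm = s') (ht : u ≫ t = t')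
    (hs : u ≫ s = s') : mapCmp F x t' s' h' ≫ F.map (pbMap (y := x) rfl u ht) =
      pbMap (y := F.obj x) rfl u hs ≫ mapCmp F x t s h := by
  have h₁ := mapCmp_lift F x t s h
  have h₂ := mapCmp_lift F x t' s' h'
  have h₃ := pbMap_lift (y := x) rfl u ht
  have h₄ := pbMap_lift (y := F.obj x) rfl u hs
  have h₅ := BasedFunctor.preserves_isHomLift F u (pbMap (y := x) rfl u ht)
  refine compare_unique (F.map (pullbackMap (p := G.p) (a := x) rfl t)) (base_eq_lift F t s h) u
    _ _ inferInstance inferInstance ?_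
  rw [Category.assoc, Category.assoc, mapCmp_fac, pbMap_fac, ← mapCmp_fac F x t' s' h',
    ← F.map_comp, pbMap_fac]

theorem mapCmp_nat {x y : G.obj} (m : x ⟶ y) {U : E} (t : U ⟶ G.p.obj x) (s : U ⟶ G.p.obj y)
    (h : t ≫ G.p.map m = s) (t' : U ⟶ G'.p.obj (F.obj x))
    (ht : t ≫ eqToHom (F.w_obj x).symm = t') (s' : U ⟶ G'.p.obj (F.obj y))
    (hs : s ≫ eqToHom (F.w_obj y).symm = s') (h' : t' ≫ G'.p.map (F.map m) = s') :
    mapCmp F y s s' hs ≫ F.map (autCmp m t s h) =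
      autCmp (F.map m) t' s' h' ≫ mapCmp F x t t' ht := by
  have h₁ := mapCmp_lift F x t t' ht
  have h₂ := mapCmp_lift F y s s' hs
  have h₃ := autCmp_lift m t s h
  have h₄ := autCmp_lift (F.map m) t' s' h'
  have h₅ := BasedFunctor.preserves_isHomLift F (𝟙 U) (autCmp m t s h)
  have h₆ := base_eq_lift F t t' ht
  refine compare_unique (F.map (pullbackMap (p := G.p) (a := x) rfl t) ≫ F.map m)
    (inferInstance : G'.p.IsHomLift (t' ≫ G'.p.map (F.map m)) _) (𝟙 U)
    _ _ inferInstance inferInstance ?_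
  rw [Category.assoc, Category.assoc, ← Category.assoc (mapCmp F x t t' ht), mapCmp_fac,
    autCmp_fac, ← F.map_comp, ← F.map_comp, autCmp_fac, mapCmp_fac]

section

variable [LocallySmall.{w} G.obj] [LocallySmall.{w} G'.obj]

/-- The action of a functor over `E` on vertical automorphisms. -/
noncomputable def SAut.map (z : G.obj) : SAut.{w} z →* SAut.{w} (F.obj z) :=
  (SAut.equiv (F.obj z)).symm.toMonoidHom.comp ((VAut.map F z).comp (SAut.equiv z).toMonoidHom)

theorem SAut.equiv_map (z : G.obj) (θ : SAut.{w} z) :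
    SAut.equiv (F.obj z) (SAut.map F z θ) = VAut.map F z (SAut.equiv z θ) :=
  (SAut.equiv (F.obj z)).apply_symm_apply _

theorem SAut.map_pull {z' z : G.obj} (c : z' ⟶ z) (θ : SAut.{w} z) :
    SAut.map F z' (SAut.pull c θ) = SAut.pull (F.map c) (SAut.map F z θ) :=
  (SAut.equiv (F.obj z')).injective (by
    rw [SAut.equiv_map, SAut.equiv_pull, SAut.equiv_pull, SAut.equiv_map, VAut.map_pull])

variable {J : GrothendieckTopology E} (hG : IsStack J G) (hG' : IsStack J G')

/-- The morphism `Aut(x) ⟶ Aut(F x)` defined by the functoriality of `F`. -/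
noncomputable def autMapApp (x : G.obj) : autSheaf hG x ⟶ autSheaf hG' (F.obj x) where
  base := eqToHom (F.w_obj x).symm
  app t s h := GrpCat.ofHom ((SAut.pull (mapCmp F x t s h)).comp (SAut.map F _))
  naturality {U V} u {t s} h {t' s'} h' ht hs := by
    refine GrpCat.hom_ext (MonoidHom.ext fun θ => ?_)
    refine (congrArg (SAut.pull (mapCmp F x t' s' h')) (SAut.map_pull F _ θ)).trans ?_
    refine (SAut.pull_comp _ _ _).symm.trans (Eq.trans ?_ (SAut.pull_comp _ _ _))
    refine congrArg (fun c => SAut.pull c (SAut.map F _ θ)) ?_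
    exact mapCmp_res F x u h h' ht hs

/-- The natural transformation `Aut(G) ⟶ Aut(G') ∘ F` defined by the functoriality of `F`. -/
noncomputable def autMap : autFunctor hG ⟶ F.toFunctor ⋙ autFunctor hG' where
  app x := autMapApp F hG hG' x
  naturality x y m := by
    have hb : G.p.map m ≫ eqToHom (F.w_obj y).symm =
        eqToHom (F.w_obj x).symm ≫ G'.p.map (F.map m) := by
      have e := IsHomLift.fac' G'.p (G.p.map m) (F.map m)
      rw [e]
      simp
    refine SliceSheaf.hom_ext hb fun {U} t s h h' => ?_
    have h₁ : (t ≫ G.p.map m) ≫ eqToHom (F.w_obj y).symm = s := (Category.assoc _ _ _).trans h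
    have h₂ : (t ≫ eqToHom (F.w_obj x).symm) ≫ G'.p.map (F.map m) = s :=
      (Category.assoc _ _ _).trans h'
    refine (SliceSheaf.comp_app (autHom hG m) (autMapApp F hG hG' y) t _ s rfl h₁ h).trans ?_
    refine Eq.trans ?_ (SliceSheaf.comp_app (autMapApp F hG hG' x) (autHom hG' (F.map m)) t _ s
      rfl h₂ h').symm
    refine GrpCat.hom_ext (MonoidHom.ext fun θ => ?_)
    refine (congrArg (SAut.pull (mapCmp F y _ s h₁)) (SAut.map_pull F _ θ)).trans ?_
    refine (SAut.pull_comp _ _ _).symm.trans (Eq.trans ?_ (SAut.pull_comp _ _ _))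
    exact congrArg (fun c => SAut.pull c (SAut.map F _ θ))
      (mapCmp_nat F m t _ rfl _ rfl s h₁ h₂)

end

end

end AutSheaf

section Gerbes

open Functor.IsPreFibered

variable {E : Type u} [Category.{w} E] {J : GrothendieckTopology E}

/-- The stack of torsors under `H`, as a category over `E`. -/
abbrev TORSC (H : Sheaf J GrpCat.{w}) : BasedCategory.{max u w, max u (w + 1)} E where
  obj := Torsc H
  p := Torsc.proj H

/-- A gerbe on the site `(E, J)`, with small sets of morphisms. -/
structure Gerbe (J : GrothendieckTopology E) where
  cat : BasedCategory.{v₁, u₁} E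
  isGerbe : IsGerbe J cat
  locallySmall : LocallySmall.{w} cat.obj

instance (G : Gerbe.{w, u, v₁, u₁} J) : IsFiberedInGroupoids G.cat := G.isGerbe.toIsFiberedInGroupoids

instance (G : Gerbe.{w, u, v₁, u₁} J) : LocallySmall.{w} G.cat.obj := G.locallySmall

/-- The functor `x ↦ Aut(x)` of a gerbe. -/
noncomputable abbrev Gerbe.aut (G : Gerbe.{w, u, v₁, u₁} J) : G.cat.obj ⥤ FAGRSC J :=
  autFunctor G.isGerbe.toIsStack

/-- The value of a functor to torsors on a vertical automorphism is a vertical automorphism. -/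
theorem base_map_vertical {H : Sheaf J GrpCat.{w}} {G : BasedCategory.{v₁, u₁} E}
    (μ : BasedFunctor G (TORSC H)) {x : G.obj} (θ : VAut x) {U : E} (v : U ⟶ (μ.obj x).base) :
    v ≫ (μ.map θ.1.hom).hom.base = v := by
  have h₁ : G.p.map θ.1.hom = 𝟙 _ := θ.2
  have h : G.p.IsHomLift (𝟙 (G.p.obj x)) θ.1.hom := h₁ ▸ inferInstance
  have := BasedFunctor.preserves_isHomLift μ (𝟙 (G.p.obj x)) θ.1.hom
  have e : (μ.map θ.1.hom).hom.base = 𝟙 (μ.obj x).base := by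
    refine (IsHomLift.fac' (Torsc.proj H) (𝟙 (G.p.obj x)) (μ.map θ.1.hom)).trans ?_
    simp only [Category.id_comp, eqToHom_trans, eqToHom_refl]
    rfl
  rw [e, Category.comp_id]

variable [IsUSite J]

/-- An `(A, Π)`-gerbe `(G, μ, j)`, for a sheaf of crossed groups `X = (A, Π)`. -/
structure CrossedGerbe (X : CrossedGroupSheaf J) where
  gerbe : Gerbe.{w, u, v₁, u₁} J
  μ : BasedFunctor gerbe.cat (TORSC X.Pi)
  isCartesian_μ : IsCartesianFunctor μ
  j : gerbe.aut ≅ μ.toFunctor ⋙ contract X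
  vertical_j (x : gerbe.cat.obj) :
    (SliceSheaf.proj J GrpCat.{w}).IsHomLift (𝟙 (gerbe.cat.p.obj x)) (j.hom.app x)
  /-- If the vertical automorphism `θ` of `x` corresponds by `j` to a section of `μ(x) ∧ A` with
  local representative `(α, a)` over `u : U ⟶ S`, then `μ(θ)(α) = α · ρ(a)`. -/
  map_rep (x : gerbe.cat.obj) (θ : SAut.{w} x) {U : E} (u : U ⟶ gerbe.cat.p.obj x)
    (v : U ⟶ (μ.obj x).base) (h : u ≫ (j.hom.app x).base = v) (α : (μ.obj x).slice.val v) (a : X.A.obj.obj (op U)) :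
    (j.hom.app x).app u v h (SAut.pull (pullbackMap (p := gerbe.cat.p) (a := x) rfl u) θ) =
      tpair (μ.obj x) X.action α a →
    (μ.map (SAut.equiv x θ).1.hom).hom.app v v (base_map_vertical μ (SAut.equiv x θ) v) α =
      (μ.obj x).act α (onSec X.ρ a)

/-- A functor `L : G ⥤ G'` over `E` is an `(f, φ)`-morphism of gerbes, for `F = (f, φ)`. -/
def IsMorphism {X Y : CrossedGroupSheaf J} (F : X ⟶ Y) (G : CrossedGerbe.{w, u, v₁, u₁} X)
    (G' : CrossedGerbe.{w, u, v₂, u₂} Y) (L : BasedFunctor G.gerbe.cat G'.gerbe.cat) : Prop :=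
  IsCartesianFunctor L ∧
  ∃ i : G.μ.toFunctor ⋙ extendFunctor F.φ ≅ L.toFunctor ⋙ G'.μ.toFunctor,
    (∀ x, (Torsc.proj Y.Pi).IsHomLift (𝟙 (G.gerbe.cat.p.obj x)) (i.hom.app x)) ∧
    ∀ x, G.j.hom.app x ≫ (extendContract F).app (G.μ.obj x) ≫ (contract Y).map (i.hom.app x) =
      (autMap L G.gerbe.isGerbe.toIsStack G'.gerbe.isGerbe.toIsStack).app x ≫
        G'.j.hom.app (L.obj x)

/-- An `(A, Π)`-equivalence of `(A, Π)`-gerbes: a morphism over the identity of `(A, Π)` which is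
an equivalence over `E`. -/
def IsCrossedEquivalence {X : CrossedGroupSheaf J} (G : CrossedGerbe.{w, u, v₁, u₁} X)
    (G' : CrossedGerbe.{w, u, v₂, u₂} X) (L : BasedFunctor G.gerbe.cat G'.gerbe.cat) : Prop :=
  IsMorphism (𝟙 X) G G' L ∧ IsEEquivalence L

end Gerbes

end CrossedGerbes

/-!
The compatibility of an `(f, φ)`-morphism `L : G ⥤ G'` with `j` and `j'` expresses, for every object
`x` of `G`, the map `Aut(x) ⟶ Aut(L x)` as a composite of isomorphisms with the map
`μ(x) ∧ A ⟶ (μ(x) ∧ Π') ∧ A'`, `(p, a) ↦ ((p, 1), f a)`. After the choice of a local section of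
`μ(x)` the latter is `f` itself, so it is bijective when `f` is (`contractFun_bijective`). Hence
`L` is bijective on the vertical automorphisms of every object
(`IsMorphism.bijectiveOnSections_autMap`, `bijective_map_of_bijectiveOnSections`).

A functor over the base between gerbes with this property is an equivalence. It is
faithful, since morphisms with the same image differ by a vertical automorphism
(`faithful_of_injective_map`). It is full, since objects of a fibre of `G` are locally isomorphic:
a morphism `L x ⟶ L y` lifts locally, and the lifts glue (`full_of_bijective_map`). Every object of
`G'` is isomorphic in its fibre to some `L x`: this holds locally because `G` locally has
objects and objects of a fibre of `G'` are locally isomorphic, and the local objects glue because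
`L` is fully faithful and `G` is a stack (`exists_vertical_preimage`). A choice of such objects
defines a quasi-inverse over the base (`isEEquivalence_of_fullyFaithful`).
-/

namespace CrossedGerbes

open Functor.IsPreFibered

/-! ### Descent of vertical morphisms -/

section HomDescent

variable {E : Type u} [Category.{w} E] {G : BasedCategory.{v₁, u₁} E} [IsFiberedInGroupoids G]
  {J : GrothendieckTopology E}

/-- Vertical morphisms agree if they agree locally: their quotient is a vertical automorphism, and
these satisfy descent. The restriction along `f` may be any morphism over `f`, not only the chosen
one. -/
theorem vertical_hom_ext (hG : IsStack J G) {S : E} {R : Sieve S} (hR : R ∈ J S) {x y : G.obj}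
    {m m' : x ⟶ y} (hm : G.p.IsHomLift (𝟙 S) m) (hm' : G.p.IsHomLift (𝟙 S) m')
    (h : ∀ ⦃V : E⦄ (f : V ⟶ S), R f →
      ∃ (z : G.obj) (c : z ⟶ x), G.p.IsHomLift f c ∧ c ≫ m = c ≫ m') : m = m' := by
  have hx : G.p.obj x = S := IsHomLift.domain_eq G.p (𝟙 S) m
  have : IsIso m' := IsFiberedInGroupoids.isIso_of_vertical S m' hm'
  let θ : VAut x := VAut.mk' (R := S) (m ≫ inv m') inferInstance
  have key : θ = 1 := by
    refine (vaut_descent hx hG hR (fun _ _ => 1) (fun _ _ _ _ _ _ => map_one _)).unique ?_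
      (fun _ _ => map_one _)
    intro V f hf
    obtain ⟨z, c, hc, e⟩ := h f hf
    refine VAut.pull_eq _ _ _ ((Category.id_comp _).trans ?_)
    have hfac := compare_fac c (pullbackMap hx f) hc inferInstance (𝟙 V) (Category.id_comp f)
    rw [← hfac, Category.assoc]
    change _ = _ ≫ c ≫ m ≫ inv m'
    rw [← Category.assoc c, e, Category.assoc, IsIso.hom_inv_id, Category.comp_id]
  have e : m ≫ inv m' = 𝟙 x := congrArg (fun k : VAut x => k.1.hom) key
  rw [← Category.comp_id m, ← IsIso.inv_hom_id m', ← Category.assoc, e, Category.id_comp]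

/-- A compatible family of vertical morphisms between the restrictions of `x` and `y` to the
members of a covering sieve descends to a vertical morphism `x ⟶ y`. -/
theorem exists_vertical_hom (hG : IsStack J G) {S : E} {R : Sieve S} (hR : R ∈ J S) {x y : G.obj}
    (hx : G.p.obj x = S) (hy : G.p.obj y = S)
    (Φ : ∀ ⦃V : E⦄ (f : V ⟶ S), R f → (pullbackObj hx f ⟶ pullbackObj hy f))
    (hΦ : ∀ ⦃V : E⦄ (f : V ⟶ S) (hf : R f), G.p.IsHomLift (𝟙 V) (Φ f hf))
    (hc : ∀ ⦃V W : E⦄ (u : W ⟶ V) {f : V ⟶ S} {f' : W ⟶ S} (h : u ≫ f = f') (hf : R f)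
      (hf' : R f'), pbMap hx u h ≫ Φ f hf = Φ f' hf' ≫ pbMap hy u h) :
    ∃ m : x ⟶ y, G.p.IsHomLift (𝟙 S) m ∧ ∀ ⦃V : E⦄ (f : V ⟶ S) (hf : R f),
      pullbackMap hx f ≫ m = Φ f hf ≫ pullbackMap hy f := by
  have := hG.descent S R hR
  let X : Cart (overCat S) G := ⟨pullFunctor hx, isCartesianFunctor_of_groupoids _⟩
  let Y : Cart (overCat S) G := ⟨pullFunctor hy, isCartesianFunctor_of_groupoids _⟩
  let τ₀ : BasedNatTrans ((restriction G R).obj X).obj ((restriction G R).obj Y).obj :=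
    { app := fun f => Φ f.obj.hom f.property
      naturality := fun f g u => hc u.hom.left (Over.w u.hom) g.property f.property
      isHomLift' := fun f => hΦ f.obj.hom f.property }
  let τ : (restriction G R).obj X ⟶ (restriction G R).obj Y := ObjectProperty.homMk τ₀
  let η : BasedNatTrans (pullFunctor hx) (pullFunctor hy) := ((restriction G R).preimage τ).hom
  have hη : ∀ ⦃V : E⦄ (f : V ⟶ S) (hf : R f), η.app (Over.mk f) = Φ f hf := by
    intro V f hf
    exact congrArg (fun k : (restriction G R).obj X ⟶ (restriction G R).obj Y =>
      k.hom.app (⟨Over.mk f, hf⟩ : R.arrows.category)) ((restriction G R).map_preimage τ)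
  have hi : IsIso (pullbackMap hx (𝟙 S)) :=
    IsFiberedInGroupoids.isIso_of_vertical S _ inferInstance
  let η₁ : pullbackObj hx (𝟙 S) ⟶ pullbackObj hy (𝟙 S) := η.app (Over.mk (𝟙 S))
  have hl : G.p.IsHomLift (𝟙 S) η₁ := η.isHomLift' (Over.mk (𝟙 S))
  refine ⟨inv (pullbackMap hx (𝟙 S)) ≫ η₁ ≫ pullbackMap hy (𝟙 S), inferInstance,
    fun V f hf => ?_⟩
  have hn : pbMap hx f (Category.comp_id f) ≫ η₁ =
      Φ f hf ≫ pbMap hy f (Category.comp_id f) :=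
    (η.naturality (Over.homMk f (Category.comp_id f) : Over.mk f ⟶ Over.mk (𝟙 S))).trans
      (congrArg (· ≫ pbMap hy f (Category.comp_id f)) (hη f hf))
  rw [← pbMap_fac hx f (Category.comp_id f), Category.assoc, IsIso.hom_inv_id_assoc,
    ← Category.assoc, hn, Category.assoc, pbMap_fac]

end HomDescent

/-! ### Fully faithful functors over the base -/

section QuasiInverse

variable {E : Type u} [Category.{w} E] {G : BasedCategory.{v₁, u₁} E}
  {G' : BasedCategory.{v₂, u₂} E}

/-- A functor that carries each morphism to a morphism over the same morphism of the base, as a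
functor over the base. The equality of functors asked of a `BasedFunctor` is replaced by conditions
on objects and morphisms. -/
def basedOfLift {X : BasedCategory.{v₁, u₁} E} {Y : BasedCategory.{v₂, u₂} E} (F : X.obj ⥤ Y.obj)
    (h₀ : ∀ x, Y.p.obj (F.obj x) = X.p.obj x)
    (h : ∀ {x y} (m : x ⟶ y), Y.p.IsHomLift (X.p.map m) (F.map m)) : BasedFunctor X Y where
  toFunctor := F
  w := CategoryTheory.Functor.ext h₀ fun x y m => by
    have := h m
    exact IsHomLift.fac' Y.p (X.p.map m) (F.map m)

/-- The quasi-inverse sends `y` to a chosen `x` over the same object of the base with `L x ≅ y`. -/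
theorem isEEquivalence_of_fullyFaithful [IsFiberedInGroupoids G] (L : BasedFunctor G G')
    [L.toFunctor.Full] [L.toFunctor.Faithful]
    (h : ∀ y : G'.obj, ∃ (x : G.obj) (m : L.obj x ≅ y), G'.p.IsHomLift (𝟙 (G'.p.obj y)) m.hom) :
    IsEEquivalence L := by
  choose X m hm using h
  have hX (y : G'.obj) : G.p.obj (X y) = G'.p.obj y :=
    (L.w_obj _).symm.trans (IsHomLift.domain_eq G'.p (𝟙 (G'.p.obj y)) (m y).hom)
  have hm' (y : G'.obj) : G'.p.IsHomLift (𝟙 (G'.p.obj y)) (m y).inv := inferInstance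
  let K₀ : G'.obj ⥤ G.obj :=
    { obj := X
      map := fun {a b} g => L.preimage ((m a).hom ≫ g ≫ (m b).inv)
      map_id := fun a => L.map_injective (by simp)
      map_comp := fun g g' => L.map_injective (by simp) }
  have K₀_map {a b : G'.obj} (g : a ⟶ b) : L.map (K₀.map g) = (m a).hom ≫ g ≫ (m b).inv :=
    L.map_preimage _
  let K : BasedFunctor G' G := basedOfLift K₀ hX fun {a b} g => by
    refine (BasedFunctor.isHomLift_iff L _ _).1 ?_
    rw [K₀_map]
    infer_instance
  refine ⟨K, isCartesianFunctor_of_groupoids K, ⟨BasedNatIso.mkNatIso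
    (NatIso.ofComponents (fun x => L.preimageIso (m (L.obj x))) fun {x y} g => L.map_injective ?_)
    fun x => ?_⟩, ⟨BasedNatIso.mkNatIso (NatIso.ofComponents m fun {a b} g => ?_) fun y => hm y⟩⟩
  · change L.map (K₀.map (L.map g) ≫ (L.preimageIso (m (L.obj y))).hom) =
      L.map ((L.preimageIso (m (L.obj x))).hom ≫ g)
    rw [L.map_comp, K₀_map]
    simp
  · refine (BasedFunctor.isHomLift_iff L _ _).1 ?_
    have e : L.map (L.preimageIso (m (L.obj x))).hom = (m (L.obj x)).hom := by simp
    have h₁ := hm (L.obj x)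
    rw [L.w_obj] at h₁
    exact e ▸ h₁
  · change L.map (K₀.map g) ≫ _ = _ ≫ g
    simp [K₀_map]

end QuasiInverse

/-! ### Functors between gerbes that are bijective on vertical automorphisms -/

section Equivalence

variable {E : Type u} [Category.{w} E] {G : BasedCategory.{v₁, u₁} E}
  {G' : BasedCategory.{v₂, u₂} E} [IsFiberedInGroupoids G] [IsFiberedInGroupoids G']
  (L : BasedFunctor G G')

/-- Two morphisms with the same image lie over the same morphism of the base, hence differ by a
vertical automorphism, whose image is trivial. -/
theorem faithful_of_injective_map (h : ∀ x, Function.Injective (VAut.map L x)) :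
    L.toFunctor.Faithful where
  map_injective {x y m m'} e := by
    have hm : G.p.IsHomLift (G.p.map m) m' := by
      refine (BasedFunctor.isHomLift_iff L _ _).1 ?_
      rw [← e]
      infer_instance
    let χ := compare m' m hm inferInstance (𝟙 _) (Category.id_comp (G.p.map m))
    have hχ : G.p.IsHomLift (𝟙 _) χ := compare_lift _ _ _ _ _ _
    have fac : χ ≫ m' = m := compare_fac _ _ _ _ _ _
    have hL : L.map χ = 𝟙 _ := by
      refine compare_unique (L.map m') (BasedFunctor.preserves_isHomLift L (G.p.map m) m') (𝟙 _) _ _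
        (BasedFunctor.preserves_isHomLift L (𝟙 _) χ) inferInstance ?_
      rw [← L.map_comp, fac, Category.id_comp]
      exact e
    have : VAut.mk' χ hχ = 1 := h x (by
      rw [map_one]
      exact VAut.ext' hL)
    have e : χ = 𝟙 x := congrArg (fun k : VAut x => k.1.hom) this
    rw [← fac, e, Category.id_comp]

variable {J : GrothendieckTopology E}

/-- A vertical morphism `L x ⟶ L y` lifts if `x` and `y` are isomorphic in their fibre: an
isomorphism reduces to the case `x = y`. -/
theorem exists_vertical_map_eq (h : ∀ x, Function.Surjective (VAut.map L x)) {S : E} {x y : G.obj}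
    (hxy : VerticallyIso G S x y) (g : L.obj x ⟶ L.obj y) (hg : G'.p.IsHomLift (𝟙 S) g) :
    ∃ m : x ⟶ y, G.p.IsHomLift (𝟙 S) m ∧ L.map m = g := by
  obtain ⟨e, he⟩ := hxy
  have hx : G.p.obj x = S := IsHomLift.domain_eq G.p (𝟙 S) e.hom
  have h' : G'.p.IsHomLift (𝟙 S) (L.map e.inv) := inferInstance
  obtain ⟨θ, hθ⟩ := h x (VAut.mk' (g ≫ L.map e.inv) (inferInstance : G'.p.IsHomLift (𝟙 S) _))
  have hθ' : L.map θ.1.hom = g ≫ L.map e.inv := congrArg (fun k : VAut _ => k.1.hom) hθ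
  have := VAut.lift θ hx
  refine ⟨θ.1.hom ≫ e.hom, inferInstance, ?_⟩
  rw [L.map_comp, hθ', Category.assoc, ← L.map_comp, e.inv_hom_id, L.map_id, Category.comp_id]

/-- Two objects of a fibre of a gerbe are locally isomorphic, so that a vertical morphism
`L x ⟶ L y` lifts locally; the local lifts are compatible because `L` is faithful, and descend. -/
theorem full_of_bijective_map (hG : IsGerbe J G) (hG' : IsStack J G')
    (h : ∀ x, Function.Bijective (VAut.map L x)) : L.toFunctor.Full := by
  have := faithful_of_injective_map L fun x => (h x).1
  have vert : ∀ {S : E} {x y : G.obj} (g : L.obj x ⟶ L.obj y), G.p.obj x = S → G.p.obj y = S →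
      G'.p.IsHomLift (𝟙 S) g → ∃ m : x ⟶ y, L.map m = g := by
    intro S x y g hx hy hg
    obtain ⟨R, hR, hloc⟩ := hG.locally_iso S x y hx hy
    -- The restriction of `g` along `f`, as a morphism between the images of the restrictions.
    let γ {V : E} (f : V ⟶ S) : L.obj (pullbackObj hx f) ⟶ L.obj (pullbackObj hy f) :=
      compare (G := G') (f := f) (f' := f) (L.map (pullbackMap hy f)) (L.map (pullbackMap hx f) ≫ g)
        inferInstance inferInstance (𝟙 V) (Category.id_comp f)
    have γ_lift {V : E} (f : V ⟶ S) : G'.p.IsHomLift (𝟙 V) (γ f) := compare_lift _ _ _ _ _ _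
    have γ_fac {V : E} (f : V ⟶ S) :
        γ f ≫ L.map (pullbackMap hy f) = L.map (pullbackMap hx f) ≫ g := compare_fac _ _ _ _ _ _
    choose Φ hΦ hΦL using fun {V : E} (f : V ⟶ S) (hf : R f) =>
      exists_vertical_map_eq L (fun x => (h x).2) (hloc f hf) (γ f) (γ_lift f)
    obtain ⟨m, hm, hmΦ⟩ := exists_vertical_hom hG.toIsStack hR hx hy (fun _ f hf => Φ f hf)
      (fun _ f hf => hΦ f hf) (by
        intro V W u f f' hu hf hf'
        refine L.map_injective ?_
        have h₁ := pbMap_lift hx u hu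
        have h₂ := pbMap_lift hy u hu
        have h₃ := hΦ f hf
        have h₄ := hΦ f' hf'
        refine compare_unique (f := f) (L.map (pullbackMap hy f)) inferInstance u _ _
          (BasedFunctor.preserves_isHomLift L u _) (BasedFunctor.preserves_isHomLift L u _) ?_
        rw [L.map_comp, L.map_comp, hΦL, hΦL, Category.assoc, Category.assoc, γ_fac, ← L.map_comp,
          pbMap_fac, γ_fac, ← Category.assoc, ← L.map_comp, pbMap_fac])
    refine ⟨m, vertical_hom_ext hG' hR inferInstance hg fun V f hf =>
      ⟨_, L.map (pullbackMap hx f), inferInstance, ?_⟩⟩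
    rw [← L.map_comp, hmΦ f hf, L.map_comp, hΦL, γ_fac]
  refine ⟨fun {x y} g => ?_⟩
  -- A morphism is a vertical one followed by the image of a cartesian one.
  let f : G.p.obj x ⟶ G.p.obj y :=
    eqToHom (L.w_obj x).symm ≫ G'.p.map g ≫ eqToHom (L.w_obj y)
  have hg : G'.p.IsHomLift f g := inferInstance
  let c := pullbackMap (p := G.p) (a := y) rfl f
  let g' := compare (G := G') (L.map c) g (BasedFunctor.preserves_isHomLift L f c) hg (𝟙 _)
    (Category.id_comp f)
  obtain ⟨m, hm⟩ := vert g' rfl (pullbackObj_proj _ _) (compare_lift _ _ _ _ _ _)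
  refine ⟨m ≫ c, ?_⟩
  refine (L.map_comp _ _).trans ?_
  rw [hm]
  exact compare_fac _ _ _ _ _ _

/-- Locally `y` is isomorphic to some `L x`, because `G` locally has an object and two objects of
`G'` are locally isomorphic. As `L` is fully faithful, the transition isomorphisms between
the local objects `L x` come from `G`, where they form a descent datum. -/
theorem exists_vertical_preimage (hG : IsGerbe J G) (hG' : IsGerbe J G') [L.toFunctor.Full]
    [L.toFunctor.Faithful] (y : G'.obj) :
    ∃ (x : G.obj) (m : L.obj x ≅ y), G'.p.IsHomLift (𝟙 (G'.p.obj y)) m.hom := by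
  obtain ⟨S, hy⟩ : ∃ S, G'.p.obj y = S := ⟨_, rfl⟩
  -- The sieve of the morphisms along which `y` comes from `G`.
  let R : Sieve S :=
    { arrows := fun V f => ∃ (x : G.obj) (m : L.obj x ⟶ y), G'.p.IsHomLift f m
      downward_closed := by
        rintro V W f ⟨x, m, hm⟩ u
        have hx : G.p.obj x = V := (L.w_obj x).symm.trans (IsHomLift.domain_eq G'.p f m)
        exact ⟨pullbackObj hx u, L.map (pullbackMap hx u) ≫ m, inferInstance⟩ }
  have hR : R ∈ J S := by
    obtain ⟨R₀, hR₀, hne⟩ := hG.locally_nonempty S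
    refine J.transitive hR₀ R fun V f hf => ?_
    obtain ⟨x, hx⟩ := hne f hf
    have hLx : G'.p.obj (L.obj x) = V := (L.w_obj x).trans hx
    obtain ⟨R₁, hR₁, hiso⟩ := hG'.locally_iso V (L.obj x) (pullbackObj hy f) hLx
      (pullbackObj_proj hy f)
    refine J.superset_covering (fun W u hu => ?_) hR₁
    obtain ⟨e, he⟩ := hiso u hu
    let c := compare (G := G') (f := u) (f' := u) (pullbackMap hLx u) (L.map (pullbackMap hx u))
      inferInstance inferInstance (𝟙 W) (Category.id_comp u)
    have hc : G'.p.IsHomLift (𝟙 W) c := compare_lift _ _ _ _ _ _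
    exact ⟨pullbackObj hx u,
      c ≫ e.hom ≫ pullbackMap (pullbackObj_proj hy f) u ≫ pullbackMap hy f, inferInstance⟩
  have hd := hG.descent S R hR
  have hd' := hG'.descent S R hR
  choose X m hm using fun {V : E} (f : V ⟶ S) (hf : R f) => hf
  have hX {V : E} (f : V ⟶ S) (hf : R f) : G.p.obj (X f hf) = V :=
    (L.w_obj _).symm.trans (IsHomLift.domain_eq G'.p f (m f hf))
  -- The transition morphisms of the descent datum.
  let c {V W : E} (u : W ⟶ V) {f : V ⟶ S} {f' : W ⟶ S} (h : u ≫ f = f') (hf : R f) (hf' : R f') :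
      L.obj (X f' hf') ⟶ L.obj (X f hf) := compare (m f hf) (m f' hf') (hm f hf) (hm f' hf') u h
  have c_lift {V W : E} (u : W ⟶ V) {f : V ⟶ S} {f' : W ⟶ S} (h : u ≫ f = f') (hf : R f)
      (hf' : R f') : G'.p.IsHomLift u (c u h hf hf') := compare_lift _ _ _ _ _ _
  have c_fac {V W : E} (u : W ⟶ V) {f : V ⟶ S} {f' : W ⟶ S} (h : u ≫ f = f') (hf : R f)
      (hf' : R f') : c u h hf hf' ≫ m f hf = m f' hf' := compare_fac _ _ _ _ _ _
  -- The descent datum in `G`, as a functor on the sieve.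
  let D₀ : R.arrows.category ⥤ G.obj :=
    { obj := fun f => X f.obj.hom f.property
      map := fun {f g} u => L.preimage (c u.hom.left (Over.w u.hom) g.property f.property)
      map_id := fun f => L.map_injective (by
        rw [L.map_preimage, L.map_id]
        refine compare_unique (m f.obj.hom f.property) (hm _ _) (𝟙 _) _ _ (c_lift _ _ _ _)
          (IsHomLift.id ((L.w_obj _).trans (hX _ _))) ?_
        exact (c_fac _ _ _ _).trans (Category.id_comp _).symm)
      map_comp := fun {f g k} u v => L.map_injective (by
        have h₁ := c_lift u.hom.left (Over.w u.hom) g.property f.property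
        have h₂ := c_lift v.hom.left (Over.w v.hom) k.property g.property
        rw [L.map_preimage, L.map_comp, L.map_preimage, L.map_preimage]
        refine compare_unique (m k.obj.hom k.property) (hm _ _) (u.hom.left ≫ v.hom.left) _ _
          (c_lift _ _ _ _) inferInstance ?_
        rw [c_fac, Category.assoc, c_fac, c_fac]) }
  have D₀_map {f g : R.arrows.category} (u : f ⟶ g) :
      L.map (D₀.map u) = c u.hom.left (Over.w u.hom) g.property f.property := L.map_preimage _
  let D : Cart (sieveCat R) G := ⟨basedOfLift (X := sieveCat R) D₀ (fun f => hX _ _)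
    (fun {f g} u => by
      refine (BasedFunctor.isHomLift_iff L _ _).1 ?_
      rw [D₀_map]
      exact c_lift _ _ _ _), isCartesianFunctor_of_groupoids _⟩
  let B : Cart (overCat S) G := (restriction G R).objPreimage D
  let i : (restriction G R).obj B ⟶ D := ((restriction G R).objObjPreimageIso D).hom
  let i₀ : BasedNatTrans ((restriction G R).obj B).obj D.obj := i.hom
  let j (f : R.arrows.category) : B.obj.obj f.obj ⟶ X f.obj.hom f.property := i₀.app f
  have j_nat {f g : R.arrows.category} (u : f ⟶ g) :
      B.obj.map u.hom ≫ j g = j f ≫ D₀.map u := i₀.naturality u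
  have j_lift (f : R.arrows.category) : G.p.IsHomLift (𝟙 f.obj.left) (j f) := i₀.isHomLift' f
  let LB : Cart (overCat S) G' := ⟨B.obj.comp L, isCartesianFunctor_of_groupoids _⟩
  let Y : Cart (overCat S) G' := ⟨pullFunctor hy, isCartesianFunctor_of_groupoids _⟩
  let k {V : E} (f : V ⟶ S) (hf : R f) : L.obj (X f hf) ⟶ pullbackObj hy f :=
    compare (pullbackMap hy f) (m f hf) inferInstance (hm f hf) (𝟙 V) (Category.id_comp f)
  have k_lift {V : E} (f : V ⟶ S) (hf : R f) : G'.p.IsHomLift (𝟙 V) (k f hf) :=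
    compare_lift _ _ _ _ _ _
  have k_fac {V : E} (f : V ⟶ S) (hf : R f) : k f hf ≫ pullbackMap hy f = m f hf :=
    compare_fac _ _ _ _ _ _
  -- The image of the glued object is compared with `y` on the sieve, hence everywhere.
  let τ₀ : BasedNatTrans ((restriction G' R).obj LB).obj ((restriction G' R).obj Y).obj :=
    { app := fun f => L.map (j f) ≫ k f.obj.hom f.property
      naturality := fun f g u => by
        have e : c u.hom.left (Over.w u.hom) g.property f.property ≫ k g.obj.hom g.property =
            k f.obj.hom f.property ≫ pbMap hy u.hom.left (Over.w u.hom) := by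
          have h₁ := c_lift u.hom.left (Over.w u.hom) g.property f.property
          have h₂ := pbMap_lift hy u.hom.left (Over.w u.hom)
          have h₃ := k_lift f.obj.hom f.property
          have h₄ := k_lift g.obj.hom g.property
          refine compare_unique (f := g.obj.hom) (pullbackMap hy g.obj.hom) inferInstance u.hom.left
            _ _ inferInstance inferInstance ?_
          rw [Category.assoc, Category.assoc, k_fac, pbMap_fac, k_fac, c_fac]
        change L.map (B.obj.map u.hom) ≫ L.map (j g) ≫ k g.obj.hom g.property =
          (L.map (j f) ≫ k f.obj.hom f.property) ≫ pbMap hy u.hom.left (Over.w u.hom)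
        rw [← Category.assoc, ← L.map_comp, j_nat, L.map_comp, D₀_map, Category.assoc, e,
          Category.assoc]
      isHomLift' := fun f => by
        have h₁ := j_lift f
        have h₂ : G'.p.IsHomLift (𝟙 f.obj.left) (k f.obj.hom f.property) := k_lift _ _
        exact IsHomLift.comp_of_lift_id G'.p f.obj.left (L.map (j f)) (k f.obj.hom f.property) }
  let τ : (restriction G' R).obj LB ⟶ (restriction G' R).obj Y := ObjectProperty.homMk τ₀
  let η : BasedNatTrans (B.obj.comp L) (pullFunctor hy) := ((restriction G' R).preimage τ).hom
  let η₁ : L.obj (B.obj.obj (Over.mk (𝟙 S))) ⟶ pullbackObj hy (𝟙 S) := η.app (Over.mk (𝟙 S))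
  have hη : G'.p.IsHomLift (𝟙 S) η₁ := η.isHomLift' (Over.mk (𝟙 S))
  let q : L.obj (B.obj.obj (Over.mk (𝟙 S))) ⟶ y := η₁ ≫ pullbackMap hy (𝟙 S)
  have hq : G'.p.IsHomLift (𝟙 S) q := inferInstance
  have : IsIso q := IsFiberedInGroupoids.isIso_of_vertical S q hq
  subst hy
  exact ⟨_, asIso q, hq⟩

end Equivalence

/-! ### Morphisms bijective on sections -/

section SectionwiseBijective

variable {E : Type u} [Category.{w} E] {J : GrothendieckTopology E}

/-- A morphism of sheaves of groups on localized sites over `f : S ⟶ T` is bijective on sections: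
it identifies the source with the restriction of the target along `f`. Unlike an isomorphism, it
need not have an invertible `f`. -/
def BijectiveOnSections {X Y : FAGRSC J} (m : X ⟶ Y) : Prop :=
  ∀ ⦃U : E⦄ (t : U ⟶ X.base) (s : U ⟶ Y.base) (h : t ≫ m.base = s),
    Function.Bijective (m.app t s h)

namespace BijectiveOnSections

variable [IsUSite J] {X Y Z : FAGRSC J}

theorem of_isIso (m : X ⟶ Y) [IsIso m] : BijectiveOnSections m := by
  have hid : ∀ {Z : FAGRSC J} (n : Z ⟶ Z), n = 𝟙 Z → ∀ {U : E} (t : U ⟶ Z.base)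
      (h : t ≫ n.base = t) (x : Z.val t), n.app t t h x = x := by
    rintro Z _ rfl U t h x
    exact ConcreteCategory.congr_hom (SliceSheaf.id_app Z t h) x
  intro U t s h
  have e₁ : m.base ≫ (inv m).base = 𝟙 X.base :=
    congrArg (fun k : X ⟶ X => k.base) (IsIso.hom_inv_id m)
  have e₂ : (inv m).base ≫ m.base = 𝟙 Y.base :=
    congrArg (fun k : Y ⟶ Y => k.base) (IsIso.inv_hom_id m)
  have h' : s ≫ (inv m).base = t := by rw [← h, Category.assoc, e₁, Category.comp_id]
  have h₁ : t ≫ (m ≫ inv m).base = t := (congrArg (t ≫ ·) e₁).trans (Category.comp_id t)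
  have h₂ : s ≫ (inv m ≫ m).base = s := (congrArg (s ≫ ·) e₂).trans (Category.comp_id s)
  refine Function.bijective_iff_has_inverse.2 ⟨(inv m).app s t h', fun x => ?_, fun y => ?_⟩
  · exact (SliceSheaf.comp_app_grp m (inv m) t s t h h' h₁ x).symm.trans
      (hid _ (IsIso.hom_inv_id m) t h₁ x)
  · exact (SliceSheaf.comp_app_grp (inv m) m s t s h' h h₂ y).symm.trans
      (hid _ (IsIso.inv_hom_id m) s h₂ y)

theorem comp {m : X ⟶ Y} {n : Y ⟶ Z} (hm : BijectiveOnSections m) (hn : BijectiveOnSections n) :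
    BijectiveOnSections (m ≫ n) := by
  intro U t r h
  have h' : (t ≫ m.base) ≫ n.base = r := (Category.assoc _ _ _).trans h
  have e : ⇑((m ≫ n).app t r h).hom = n.app _ r h' ∘ m.app t _ rfl :=
    funext (SliceSheaf.comp_app_grp m n t _ r rfl h' h)
  exact e ▸ (hn _ _ _).comp (hm _ _ _)

theorem of_comp {m : X ⟶ Y} {n : Y ⟶ Z} (hmn : BijectiveOnSections (m ≫ n))
    (hn : BijectiveOnSections n) : BijectiveOnSections m := by
  intro U t s h
  have h'' : t ≫ (m ≫ n).base = s ≫ n.base := by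
    rw [← h, Category.assoc]
    rfl
  have e : ⇑((m ≫ n).app t (s ≫ n.base) h'').hom = n.app s _ rfl ∘ m.app t s h :=
    funext (SliceSheaf.comp_app_grp m n t s _ h rfl h'')
  refine ((hn s _ rfl).of_comp_iff' _).1 ?_
  rw [← e]
  exact hmn _ _ _

end BijectiveOnSections

/-- The map `(p, a) ↦ (m p, k a)` between contracted products is bijective as soon as `k` is:
locally on the base of `P`, the choice of a section of `P` turns it into `k`. -/
theorem contractFun_bijective [IsUSite J] {H H' A A' : Sheaf J GrpCat.{w}} {φ : H ⟶ H'}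
    (k : A ⟶ A') {L : LeftAction H (setSheaf A)} {L' : LeftAction H' (setSheaf A')}
    (hk : ∀ {U : E} (g : H.obj.obj (op U)) (a : A.obj.obj (op U)),
      onSec k (gsmul L g a) = gsmul L' (onSec φ g) (onSec k a))
    {P : Torsc H} {P' : Torsc H'} (m : TorsorHom φ P P')
    (hbij : ∀ U : E, Function.Bijective (onSec k (U := U))) {U : E} (t : U ⟶ P.base)
    (s : U ⟶ P'.base) (h : t ≫ m.hom.base = s) :
    Function.Bijective (contractFun (L := L) (L' := L') k hk m t s h) := by
  have hw {V : Over P.base} (u : V ⟶ Over.mk t) : u.left ≫ s = V.hom ≫ m.hom.base := by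
    rw [← h, ← Category.assoc]
    exact congrArg (· ≫ m.hom.base) (Over.w u)
  constructor
  · intro x y hxy
    refine sep_torsor P.torsor (contracted P.torsor (L.over P.base)) (U := Over.mk t)
      (x := x) (y := y) fun V u p => ?_
    have e := (contractFun_spec k hk m t s h x u.left V.hom _ (Over.w u) (hw u) rfl p).symm.trans
      ((congrArg _ hxy).trans
        (contractFun_spec k hk m t s h y u.left V.hom _ (Over.w u) (hw u) rfl p))
    have e' := (hbij _).1 (gpair_injective P'.torsor (L'.over P'.base)
      (U := Over.mk (V.hom ≫ m.hom.base)) _ e)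
    refine (spair_scoord (L := L) (t := V.hom) p _).symm.trans
      (Eq.trans ?_ (spair_scoord (L := L) (t := V.hom) p _))
    exact congrArg (spair P L (t := V.hom) p) e'
  · intro z
    choose q hq using fun (U : E) => (hbij U).2
    -- If `z = (m p, a')` locally, its preimage is `(p, k⁻¹ a')`, whatever the choice of `p`.
    obtain ⟨x, hx, -⟩ := glue P.torsor (contracted P.torsor (L.over P.base)) (U := Over.mk t)
      (fun V u p => spair P L (t := V.hom) p (q V.left (scoord P' L' (m.ap V.hom _ rfl p)
        ((cslice P' L').valMap u.left (hw u) z)))) (by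
        intro V W v u p
        have hv : v.left ≫ V.hom = W.hom := Over.w v
        have hv' : v.left ≫ V.hom ≫ m.hom.base = W.hom ≫ m.hom.base := by
          rw [← Category.assoc, hv]
        refine (spair_res (L := L) v.left hv p _).trans ?_
        refine congrArg (spair P L (t := W.hom) (P.slice.valMap v.left hv p)) ?_
        refine (hbij _).1 ((hom_gres k _ _).symm.trans (Eq.trans ?_ (hq _ _).symm))
        refine (congrArg _ (hq _ _)).trans ?_
        refine (scoord_res (L := L') v.left hv' _ _).symm.trans ?_
        rw [m.ap_res v.left _ rfl hv hv', valMap_valMap]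
        rfl) (by
        intro V u p g
        have hm : m.ap V.hom _ rfl (P.act (t := V.hom) p g) =
          P'.act (m.ap V.hom _ rfl p) (onSec φ g) := m.map_act V.hom _ rfl p g
        refine (spair_act (L := L) (t := V.hom) p g _).trans ?_
        refine congrArg (spair P L (t := V.hom) p) ((hbij _).1 ?_)
        refine (hk _ _).trans (Eq.trans ?_ (hq _ _).symm)
        refine (congrArg _ ((hq _ _).trans ((congrArg (fun a => scoord P' L' a _) hm).trans
          (scoord_act (L := L') _ _ _)))).trans ?_
        exact gsmul_inv_smul L' _ _)
    refine ⟨x, slice_sep P (cslice P' L') m.hom.base t s h fun V u t' s' ht hs p => ?_⟩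
    obtain rfl : t' ≫ m.hom.base = s' := by rw [← ht, ← hs, ← h, Category.assoc]
    refine (contractFun_spec k hk m t s h x u t' _ ht hs rfl p).trans ?_
    have hxu : (cslice P L).valMap u ht x = spair P L p (q V (scoord P' L'
        (m.ap t' _ rfl p) ((cslice P' L').valMap u hs z))) :=
      hx (Over.homMk u ht : Over.mk t' ⟶ Over.mk t) p
    rw [hxu, scoord_spair, hq, spair_scoord]

theorem BijectiveOnSections.twistHom [IsUSite J] {H H' A A' : Sheaf J GrpCat.{w}} {φ : H ⟶ H'}
    (k : A ⟶ A') {L : GroupAction H A} {L' : GroupAction H' A'}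
    (hk : ∀ {U : E} (g : H.obj.obj (op U)) (a : A.obj.obj (op U)),
      onSec k (L.act U g a) = L'.act U (onSec φ g) (onSec k a))
    {P : Torsc H} {P' : Torsc H'} (m : TorsorHom φ P P')
    (hbij : ∀ U : E, Function.Bijective (onSec k (U := U))) :
    BijectiveOnSections (twistHom k hk m) :=
  fun _ t s h => contractFun_bijective (L := L.toLeft) (L' := L'.toLeft) k hk m hbij t s h

end SectionwiseBijective

/-! ### From the sheaf of automorphisms to vertical automorphisms -/

section VerticalAutomorphisms

variable {E : Type u} [Category.{w} E] {G : BasedCategory.{v₁, u₁} E}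
  [IsFiberedInGroupoids G]

theorem VAut.pull_bijective {z' z : G.obj} (c : z' ⟶ z) [IsIso c] :
    Function.Bijective (VAut.pull c) :=
  ⟨VAut.pull_injective c, fun θ => ⟨VAut.pull (inv c) θ, by
    rw [← VAut.pull_comp, IsIso.hom_inv_id, VAut.pull_id]⟩⟩

variable {G' : BasedCategory.{v₂, u₂} E} [IsFiberedInGroupoids G'] [LocallySmall.{w} G.obj]
  [LocallySmall.{w} G'.obj] {J : GrothendieckTopology E} (hG : IsStack J G) (hG' : IsStack J G')

/-- The sections of `Aut(x)` over the identity are the vertical automorphisms of the chosen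
restriction of `x` along the identity, which is isomorphic but not equal to `x`. -/
theorem bijective_map_of_bijectiveOnSections (L : BasedFunctor G G') (x : G.obj)
    (h : BijectiveOnSections ((autMap L hG hG').app x)) : Function.Bijective (VAut.map L x) := by
  let z := pullbackObj (p := G.p) (a := x) rfl (𝟙 _)
  let c : z ⟶ x := pullbackMap (p := G.p) (a := x) rfl (𝟙 _)
  have hc : IsIso c := IsFiberedInGroupoids.isIso_of_vertical (G.p.obj x) c inferInstance
  let d := mapCmp L x (𝟙 _) _ rfl
  have hd : IsIso d := IsFiberedInGroupoids.isIso_of_vertical (G.p.obj x) d (mapCmp_lift _ _ _ _ _)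
  have h₁ : Function.Bijective fun θ => SAut.pull.{w} d (SAut.map.{w} L z θ) := h (𝟙 _) _ rfl
  have h₂ : Function.Bijective (VAut.pull d ∘ VAut.map L z) := by
    have e : VAut.pull d ∘ VAut.map L z = SAut.equiv.{w} _ ∘
        (fun θ => SAut.pull.{w} d (SAut.map.{w} L z θ)) ∘ (SAut.equiv.{w} z).symm := by
      funext θ
      simp only [Function.comp_apply]
      rw [SAut.equiv_pull, SAut.equiv_map, MulEquiv.apply_symm_apply]
    rw [e]
    exact (SAut.equiv _).bijective.comp (h₁.comp (SAut.equiv z).symm.bijective)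
  have h₃ := ((VAut.pull_bijective d).of_comp_iff' _).1 h₂
  have h₄ : VAut.map L z ∘ VAut.pull c = VAut.pull (L.map c) ∘ VAut.map L x :=
    funext (VAut.map_pull L c)
  refine ((VAut.pull_bijective (L.map c)).of_comp_iff' _).1 ?_
  rw [← h₄]
  exact h₃.comp (VAut.pull_bijective c)

end VerticalAutomorphisms

/-! ### Morphisms of gerbes over a morphism of crossed groups -/

section Morphisms

variable {E : Type u} [Category.{w} E] {J : GrothendieckTopology E}

theorem CrossedGroupSheaf.bijective_onSec_of_isIso {X Y : CrossedGroupSheaf J} (F : X ⟶ Y)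
    [IsIso F] (U : E) : Function.Bijective (onSec F.f (U := U)) := by
  have e₁ : F.f ≫ (inv F).f = 𝟙 _ := congrArg Hom.f (IsIso.hom_inv_id F)
  have e₂ : (inv F).f ≫ F.f = 𝟙 _ := congrArg Hom.f (IsIso.inv_hom_id F)
  refine Function.bijective_iff_has_inverse.2 ⟨onSec (inv F).f, fun a => ?_, fun a => ?_⟩
  · exact congrArg (fun k : X.A ⟶ X.A => onSec k a) e₁
  · exact congrArg (fun k : Y.A ⟶ Y.A => onSec k a) e₂

variable [IsUSite J]

/-- The compatibility of `L` with `j` and `j'` identifies `Aut(L)` with the map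
`(p, a) ↦ ((p, 1), f a)`, up to isomorphisms. -/
theorem IsMorphism.bijectiveOnSections_autMap {X Y : CrossedGroupSheaf J} {F : X ⟶ Y}
    {G : CrossedGerbe.{w, u, v₁, u₁} X} {G' : CrossedGerbe.{w, u, v₂, u₂} Y}
    {L : BasedFunctor G.gerbe.cat G'.gerbe.cat} (hL : IsMorphism F G G' L)
    (hF : ∀ U : E, Function.Bijective (onSec F.f (U := U))) (x : G.gerbe.cat.obj) :
    BijectiveOnSections
      ((autMap L G.gerbe.isGerbe.toIsStack G'.gerbe.isGerbe.toIsStack).app x) := by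
  obtain ⟨-, i, -, hi⟩ := hL
  refine BijectiveOnSections.of_comp (n := G'.j.hom.app (L.obj x)) ?_
    (BijectiveOnSections.of_isIso _)
  rw [← hi x]
  have hj := BijectiveOnSections.of_isIso (G.j.hom.app x)
  have hf := BijectiveOnSections.twistHom F.f F.map_act' (toExtend F.φ (G.μ.obj x)) hF
  have hi := BijectiveOnSections.of_isIso ((contract Y).mapIso (i.app x)).hom
  exact hj.comp (hf.comp hi)

theorem IsMorphism.isEEquivalence {X Y : CrossedGroupSheaf J} {F : X ⟶ Y}
    {G : CrossedGerbe.{w, u, v₁, u₁} X} {G' : CrossedGerbe.{w, u, v₂, u₂} Y}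
    {L : BasedFunctor G.gerbe.cat G'.gerbe.cat} (hL : IsMorphism F G G' L)
    (hF : ∀ U : E, Function.Bijective (onSec F.f (U := U))) : IsEEquivalence L := by
  have hG := G.gerbe.isGerbe
  have hG' := G'.gerbe.isGerbe
  have h : ∀ x, Function.Bijective (VAut.map L x) := fun x =>
    bijective_map_of_bijectiveOnSections hG.toIsStack hG'.toIsStack L x
      (hL.bijectiveOnSections_autMap hF x)
  have := full_of_bijective_map L hG hG'.toIsStack h
  have := faithful_of_injective_map L fun x => (h x).1
  exact isEEquivalence_of_fullyFaithful L (exists_vertical_preimage L hG hG')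

end Morphisms

end CrossedGerbes

theorem theorem234 {E : Type u} [Category.{w} E] (J : GrothendieckTopology E)
    [CrossedGerbes.IsUSite J] :
    (∀ {X Y : CrossedGerbes.CrossedGroupSheaf J} (F : X ⟶ Y) [IsIso F]
      (G : CrossedGerbes.CrossedGerbe.{w, u, v₁, u₁} X)
      (G' : CrossedGerbes.CrossedGerbe.{w, u, v₂, u₂} Y)
      (L : BasedFunctor G.gerbe.cat G'.gerbe.cat),
        CrossedGerbes.IsMorphism F G G' L → CrossedGerbes.IsEEquivalence L) ∧
    (∀ {X : CrossedGerbes.CrossedGroupSheaf J}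
      (G : CrossedGerbes.CrossedGerbe.{w, u, v₁, u₁} X)
      (G' : CrossedGerbes.CrossedGerbe.{w, u, v₂, u₂} X)
      (L : BasedFunctor G.gerbe.cat G'.gerbe.cat),
        CrossedGerbes.IsMorphism (𝟙 X) G G' L → CrossedGerbes.IsCrossedEquivalence G G' L) :=
  ⟨fun F _ _ _ _ hL =>
    hL.isEEquivalence (CrossedGerbes.CrossedGroupSheaf.bijective_onSec_of_isIso F),
  fun _ _ _ hL => ⟨hL,
    hL.isEEquivalence (CrossedGerbes.CrossedGroupSheaf.bijective_onSec_of_isIso (𝟙 _))⟩⟩
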